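/- **Theorem (Quantum Cramér–Rao inequalities).** Let $\mathcal H$ be a separable complex Hilbert space and $\Xi$ a separable real Hilbert space, each of finite or infinite dimension. Let $\Theta\subseteq\Xi$ be a set at whose points derivatives relative to $\Theta$ are unique (for example an open set), and let $(\rho(\theta))_{\theta\in\Theta}$ be a family of density operators on $\mathcal H$ with $\rho(\theta)>0$, i.e. $\langle x,\rho(\theta)x\rangle>0$ for $x\ne0$, such that $\rho:\Theta\to\mathcal T(\mathcal H)$ is Fréchet differentiable for the trace norm, with derivative $D_\theta\rho$. Fix $\theta\in\Theta$ and write $\rho=\rho(\theta)$, $(A,B)_{\mathrm{HS}}=\operatorname{Tr}[A^*B]$. *Measurements.* For a POVM $M$ on a measurable space $(\Omega,\mathfrak B)$ (discrete or continuous) let $P^M_\vartheta(B)=\operatorname{Tr}[\rho(\vartheta)M(B)]$. The logarithmic derivative $l_\theta(\cdot\,;\phi)$ is the Radon–Nikodým derivative of $B\mapsto D_\theta P^M_\theta(B)[\phi]$ with respect to $P^M_\theta$, and the Fisher information operator $J^M_\theta$ is the bounded operator on $\Xi$ with $(\phi,J^M_\theta\chi)_\Xi=\int_\Omega l_\theta(x;\phi)\,l_\theta(x;\chi)\,P^M_\theta(dx)$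 for all $\phi,\chi\in\Xi$, the $l_\theta(\cdot\,;\phi)$ being square integrable. *Quantum Fisher information.* The symmetric logarithmic derivative $L^{\mathrm S}(\phi)$ is the symmetric, possibly unbounded, solution of $\tfrac12(\rho L+L\rho)=D_\theta\rho[\phi]$ with finite second moment. Precisely, it is given by the Hilbert–Schmidt operator $A_\phi=L^{\mathrm S}(\phi)\sqrt\rho$ such that $\sqrt\rho A_\phi$ is self-adjoint and $\tfrac12(\sqrt\rho A_\phi^*+A_\phi\sqrt\rho)=D_\theta\rho[\phi]$. The right logarithmic derivative $L^{\mathrm R}(\phi)$ is the solution of $\rho L=D_\theta\rho[\phi]$, given by the Hilbert–Schmidt operator $Y_\phi=\sqrt\rho L^{\mathrm R}(\phi)$ such that $\sqrt\rho Y_\phi=D_\theta\rho[\phi]$. The SLD Fisher information operator $J^{\mathrm S}_\theta$ on $\Xi$ and the RLD Fisher information operator $J^{\mathrm R}_\theta$ on the complexification $\tilde\Xi=\Xi+\mathrm i\,\Xi$ are the bounded operators with $$(\phi,J^{\mathrm S}_\theta\chi)_\Xi=\operatorname{Tr}\big[\tfrac12(\rho L^{\mathrm S}(\phi)+L^{\mathrm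 S}(\phi)\rho)L^{\mathrm S}(\chi)\big]=\operatorname{Re}(A_\phi,A_\chi)_{\mathrm{HS}}\quad(\phi,\chi\in\Xi),$$ $$(\phi,J^{\mathrm R}_\theta\chi)_{\tilde\Xi}=\tilde H(\phi,\chi)\quad(\phi,\chi\in\tilde\Xi),$$ where $\tilde H$ is the sesquilinear extension to $\tilde\Xi$ of $H(\phi,\chi)=\operatorname{Tr}[(\rho L^{\mathrm R}(\phi))^*L^{\mathrm R}(\chi)]=(Y_\phi,Y_\chi)_{\mathrm{HS}}$. 1. If $L^{\mathrm S}(\phi)$ exists for every $\phi\in\Xi$, then $J^{\mathrm S}_\theta$ exists and is unique, and for every POVM $M$ the operator $J^M_\theta$ exists, is unique, and satisfies $J^M_\theta\le J^{\mathrm S}_\theta$. If $L^{\mathrm R}(\phi)$ exists for every $\phi\in\Xi$, then $J^{\mathrm R}_\theta$ exists and is unique, and for every POVM $M$ the operator $J^M_\theta$ exists, is unique, and its complex linear extension to $\tilde\Xi$ satisfies $J^M_\theta\le J^{\mathrm R}_\theta$. 2. If $L^{\mathrm S}(\phi)$ exists for every $\phi\in\Xi$, then for every $\phi\in\Xi$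 $$\max_M\,(\phi,J^M_\theta\phi)_\Xi=(\phi,J^{\mathrm S}_\theta\phi)_\Xi ,$$ where $M$ runs over all POVMs on all measurable spaces, and the maximum is attained. -/

import Mathlib

open MeasureTheory Filter Topology
open scoped InnerProductSpace ENNReal

universe w

noncomputable section

set_option linter.unusedSectionVars false

namespace QEst

/-! ### Hilbert–Schmidt and trace class operators -/

section Operators

variable {H : Type*} [NormedAddCommGroup H] [InnerProductSpace ℂ H] [CompleteSpace H]

variable (H) in
/-- Index set of an orthonormal (Hilbert) basis of `H`, fixed once and for all. -/
def basisIndex : Set H := (exists_hilbertBasis ℂ H).choose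

variable (H) in
/-- A fixed orthonormal (Hilbert) basis of `H`. The notions below do not depend on the choice. -/
def stdBasis : HilbertBasis (basisIndex H) ℂ H := (exists_hilbertBasis ℂ H).choose_spec.choose

/-- `A` is a Hilbert–Schmidt operator: `∑ᵢ ‖A eᵢ‖² < ∞`. -/
def IsHilbertSchmidt (A : H →L[ℂ] H) : Prop :=
  Summable fun i => ‖A (stdBasis H i)‖ ^ 2

/-- The Hilbert–Schmidt inner product `(A, B)_HS = Tr[A* B]`, conjugate linear in `A`. -/
def hsInner (A B : H →L[ℂ] H) : ℂ :=
  ∑' i, ⟪A (stdBasis H i), B (stdBasis H i)⟫_ℂ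

/-- The trace norm `‖T‖₁ = Tr √(T* T)`, with value `∞` when `T` is not of trace class. -/
def traceNorm (T : H →L[ℂ] H) : ℝ≥0∞ :=
  ∑' i, ENNReal.ofReal (⟪stdBasis H i, CFC.sqrt (star T * T) (stdBasis H i)⟫_ℂ).re

/-- `T` is of trace class. -/
def IsTraceClass (T : H →L[ℂ] H) : Prop := traceNorm T < ∞

/-- The trace of a trace class operator. -/
def trace (T : H →L[ℂ] H) : ℂ := ∑' i, ⟪stdBasis H i, T (stdBasis H i)⟫_ℂ

/-- Density operators: positive trace class operators of trace one. -/
structure IsDensity (r : H →L[ℂ] H) : Prop where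
  isPositive : r.IsPositive
  isTraceClass : IsTraceClass r
  trace_eq_one : trace r = 1

theorem IsDensity.sqrt_mul_sqrt {r : H →L[ℂ] H} (hr : IsDensity r) :
    CFC.sqrt r * CFC.sqrt r = r :=
  CFC.sqrt_mul_sqrt_self r ((ContinuousLinearMap.nonneg_iff_isPositive r).2 hr.isPositive)

theorem IsDensity.isHilbertSchmidt_sqrt {r : H →L[ℂ] H} (hr : IsDensity r) :
    IsHilbertSchmidt (CFC.sqrt r) := by
  have h0 : 0 ≤ r := (ContinuousLinearMap.nonneg_iff_isPositive r).2 hr.isPositive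
  have h1 : CFC.sqrt (star r * r) = r := by
    rw [h0.isSelfAdjoint.star_eq, CFC.sqrt_mul_self r h0]
  have h2 : ∀ x : H, ‖CFC.sqrt r x‖ ^ 2 = (⟪x, r x⟫_ℂ).re := fun x => by
    have hs : star (CFC.sqrt r) = CFC.sqrt r := (CFC.sqrt_nonneg r).isSelfAdjoint.star_eq
    have h3 : r x = star (CFC.sqrt r) (CFC.sqrt r x) := by
      rw [hs]; exact congrArg (fun T : H →L[ℂ] H => T x) hr.sqrt_mul_sqrt.symm
    rw [h3, ContinuousLinearMap.star_eq_adjoint, ContinuousLinearMap.adjoint_inner_right]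
    exact norm_sq_eq_re_inner (𝕜 := ℂ) _
  have h4 := hr.isTraceClass
  rw [IsTraceClass, traceNorm, h1] at h4
  unfold IsHilbertSchmidt
  simp only [h2]
  refine (ENNReal.summable_toReal h4.ne).congr fun i => ?_
  rw [ENNReal.toReal_ofReal]
  rw [← h2]; positivity

/-- The strict positivity `r > 0`. -/
def IsStrictlyPos (r : H →L[ℂ] H) : Prop := ∀ x : H, x ≠ 0 → 0 < (⟪x, r x⟫_ℂ).re

/-- Fréchet differentiability at `θ`, relative to `Θ`, of a map into the trace class equipped with
the trace norm: `D` is a linear map into the trace class which is bounded for the trace norm, and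
`‖ρ(θ') - ρ(θ) - D[θ' - θ]‖₁ = o(‖θ' - θ‖)` as `θ' → θ` in `Θ`. -/
structure HasTraceFDerivWithinAt {Ξ : Type*} [NormedAddCommGroup Ξ] [InnerProductSpace ℝ Ξ]
    (ρ : Ξ → H →L[ℂ] H) (D : Ξ →ₗ[ℝ] (H →L[ℂ] H)) (Θ : Set Ξ) (θ : Ξ) : Prop where
  bounded : ∃ C : ℝ, ∀ φ, traceNorm (D φ) ≤ ENNReal.ofReal (C * ‖φ‖)
  isLittleO : ∀ ε : ℝ, 0 < ε → ∀ᶠ θ' in 𝓝[Θ] θ,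
    traceNorm (ρ θ' - ρ θ - D (θ' - θ)) ≤ ENNReal.ofReal (ε * ‖θ' - θ‖)

/-! ### Logarithmic derivatives of a density operator -/

/-- `A` represents a symmetric logarithmic derivative `L` of the state `r` for the derivative `d`,
that is a solution of `(r L + L r) / 2 = d`, where `L` is a possibly unbounded symmetric operator
of finite second moment in the state `r` (an element of the space `L²(r)`). As usual such an `L`
is given by the Hilbert–Schmidt operator `A = L √r`: it is the operator with domain the range of
`√r` that maps `√r x` to `A x`. It is symmetric if and only if `√r A = √r L √r` is self-adjoint,
and then `L r = A √r` and `r L = √r A*`. -/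
structure IsSLD (r d A : H →L[ℂ] H) : Prop where
  isHilbertSchmidt : IsHilbertSchmidt A
  isSelfAdjoint : IsSelfAdjoint (CFC.sqrt r * A)
  eqn : (2⁻¹ : ℂ) • (CFC.sqrt r * star A + A * CFC.sqrt r) = d

/-- `Y` represents the right logarithmic derivative `L` of the state `r` for the derivative `d`,
that is the solution of `r L = d`, in the Hilbert space obtained by completing the bounded
operators for the inner product `Tr[X* r Z]`. As usual its elements `L` are given by the
Hilbert–Schmidt operator `Y = √r L`. -/
structure IsRLD (r d Y : H →L[ℂ] H) : Prop where
  isHilbertSchmidt : IsHilbertSchmidt Y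
  eqn : CFC.sqrt r * Y = d

/-- For a bounded operator `L` the notion is the literal one. -/
theorem IsSLD.of_bounded {r d L : H →L[ℂ] H} (hr : IsDensity r) (hL : IsSelfAdjoint L)
    (h : (2⁻¹ : ℂ) • (r * L + L * r) = d) : IsSLD r d (L * CFC.sqrt r) := by
  have hs : star (CFC.sqrt r) = CFC.sqrt r := (CFC.sqrt_nonneg r).isSelfAdjoint.star_eq
  have hq : CFC.sqrt r * CFC.sqrt r = r := hr.sqrt_mul_sqrt
  refine ⟨?_, ?_, ?_⟩
  · refine Summable.of_nonneg_of_le (fun _ => by positivity) (fun i => ?_)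
      (hr.isHilbertSchmidt_sqrt.mul_left (‖L‖ ^ 2))
    rw [← mul_pow]
    exact pow_le_pow_left₀ (norm_nonneg _) (L.le_opNorm _) 2
  · simp [isSelfAdjoint_iff, hs, hL.star_eq, mul_assoc]
  · rw [← h, star_mul, hs, hL.star_eq, ← mul_assoc, hq, mul_assoc, hq]

/-- For a bounded operator `L` the notion is the literal one (`√r L` is then Hilbert–Schmidt because
`√r` is). -/
theorem IsRLD.of_bounded {r d L : H →L[ℂ] H} (hr : IsDensity r) (h : r * L = d)
    (hL : IsHilbertSchmidt (CFC.sqrt r * L)) : IsRLD r d (CFC.sqrt r * L) :=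
  ⟨hL, by rw [← mul_assoc, hr.sqrt_mul_sqrt, h]⟩

end Operators

/-! ### The complexification of a real Hilbert space -/

/-- The complexification `Ξ + i Ξ` of a real Hilbert space; `(φ₁, φ₂)` stands for `φ₁ + i φ₂`. -/
def Cx (Ξ : Type*) : Type _ := WithLp 2 (Ξ × Ξ)

namespace Cx

variable {Ξ : Type*} [NormedAddCommGroup Ξ] [InnerProductSpace ℝ Ξ]

instance : NormedAddCommGroup (Cx Ξ) := inferInstanceAs (NormedAddCommGroup (WithLp 2 (Ξ × Ξ)))

/-- The vector `φ₁ + i φ₂`. -/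
def mk (φ₁ φ₂ : Ξ) : Cx Ξ := WithLp.toLp 2 (φ₁, φ₂)

/-- The real part. -/
def re (φ : Cx Ξ) : Ξ := WithLp.fst (p := 2) (α := Ξ) (β := Ξ) φ

/-- The imaginary part. -/
def im (φ : Cx Ξ) : Ξ := WithLp.snd (p := 2) (α := Ξ) (β := Ξ) φ

@[ext] theorem ext {φ χ : Cx Ξ} (h₁ : φ.re = χ.re) (h₂ : φ.im = χ.im) : φ = χ :=
  WithLp.ofLp_injective 2 (Prod.ext h₁ h₂)

@[simp] theorem re_mk (a b : Ξ) : (mk a b).re = a := rfl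
@[simp] theorem im_mk (a b : Ξ) : (mk a b).im = b := rfl
@[simp] theorem re_add (φ χ : Cx Ξ) : (φ + χ).re = φ.re + χ.re := rfl
@[simp] theorem im_add (φ χ : Cx Ξ) : (φ + χ).im = φ.im + χ.im := rfl
@[simp] theorem re_zero : (0 : Cx Ξ).re = 0 := rfl
@[simp] theorem im_zero : (0 : Cx Ξ).im = 0 := rfl

theorem norm_sq (φ : Cx Ξ) : ‖φ‖ ^ 2 = ‖φ.re‖ ^ 2 + ‖φ.im‖ ^ 2 :=
  WithLp.prod_norm_sq_eq_of_L2 (α := Ξ) (β := Ξ) φ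

instance : SMul ℂ (Cx Ξ) where
  smul z φ := mk (z.re • φ.re - z.im • φ.im) (z.re • φ.im + z.im • φ.re)

@[simp] theorem re_smul (z : ℂ) (φ : Cx Ξ) : (z • φ).re = z.re • φ.re - z.im • φ.im := rfl
@[simp] theorem im_smul (z : ℂ) (φ : Cx Ξ) : (z • φ).im = z.re • φ.im + z.im • φ.re := rfl

instance : Module ℂ (Cx Ξ) where
  one_smul φ := by ext <;> simp
  mul_smul z w φ := by ext <;> simp <;> module
  smul_zero z := by ext <;> simp
  smul_add z φ χ := by ext <;> simp <;> module
  add_smul z w φ := by ext <;> simp <;> module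
  zero_smul φ := by ext <;> simp

instance : Inner ℂ (Cx Ξ) where
  inner φ χ := ⟨⟪φ.re, χ.re⟫_ℝ + ⟪φ.im, χ.im⟫_ℝ, ⟪φ.re, χ.im⟫_ℝ - ⟪φ.im, χ.re⟫_ℝ⟩

theorem inner_def (φ χ : Cx Ξ) :
    ⟪φ, χ⟫_ℂ = ⟨⟪φ.re, χ.re⟫_ℝ + ⟪φ.im, χ.im⟫_ℝ, ⟪φ.re, χ.im⟫_ℝ - ⟪φ.im, χ.re⟫_ℝ⟩ := rfl

theorem norm_smul_eq (z : ℂ) (φ : Cx Ξ) : ‖z • φ‖ = ‖z‖ * ‖φ‖ := by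
  rw [← sq_eq_sq₀ (norm_nonneg _) (by positivity), mul_pow, norm_sq, norm_sq, Complex.sq_norm,
    Complex.normSq_apply, re_smul, im_smul, @norm_sub_sq_real, @norm_add_sq_real]
  simp only [norm_smul, mul_pow, inner_smul_left, inner_smul_right, Real.norm_eq_abs, sq_abs,
    real_inner_comm φ.re φ.im, conj_trivial]
  ring

instance : InnerProductSpace ℂ (Cx Ξ) where
  norm_smul_le z φ := (norm_smul_eq z φ).le
  norm_sq_eq_re_inner φ := by
    rw [norm_sq, inner_def]
    simp
  conj_inner_symm φ χ := by
    apply Complex.ext <;> simp [inner_def, real_inner_comm]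
  add_left φ χ ψ := by
    apply Complex.ext <;> simp [inner_def, inner_add_left] <;> ring
  smul_left φ χ z := by
    apply Complex.ext <;>
      simp [inner_def, inner_add_left, inner_sub_left, inner_smul_left] <;> ring

/-- The complex linear extension of a bounded operator on `Ξ` to the complexification. -/
def map (J : Ξ →L[ℝ] Ξ) : Cx Ξ →L[ℂ] Cx Ξ :=
  LinearMap.mkContinuous
    { toFun := fun φ => mk (J φ.re) (J φ.im)
      map_add' := fun φ χ => by ext <;> simp
      map_smul' := fun z φ => by ext <;> simp }
    ‖J‖ (fun φ => by
      refine le_of_sq_le_sq ?_ (by positivity)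
      have h₁ := pow_le_pow_left₀ (norm_nonneg _) (J.le_opNorm φ.re) 2
      have h₂ := pow_le_pow_left₀ (norm_nonneg _) (J.le_opNorm φ.im) 2
      rw [mul_pow] at h₁ h₂ ⊢
      rw [norm_sq φ, mul_add]
      exact (norm_sq _).trans_le (add_le_add h₁ h₂))

@[simp] theorem re_map (J : Ξ →L[ℝ] Ξ) (φ : Cx Ξ) : (map J φ).re = J φ.re := rfl
@[simp] theorem im_map (J : Ξ →L[ℝ] Ξ) (φ : Cx Ξ) : (map J φ).im = J φ.im := rfl

end Cx

/-! ### Classical Fisher information -/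

section Classical

variable {Ξ : Type*} [NormedAddCommGroup Ξ] [InnerProductSpace ℝ Ξ]
  {Ω : Type*} [MeasurableSpace Ω]

/-- `l` is the logarithmic derivative at `θ` in the direction `φ` of the family `P` of measures:
the Radon–Nikodým derivative with respect to `P θ` of the set function `B ↦ D_θ P_θ(B)[φ]`. -/
structure IsLogDeriv (P : Ξ → Measure Ω) (Θ : Set Ξ) (θ φ : Ξ) (l : Ω → ℝ) : Prop where
  integrable : Integrable l (P θ)
  eqn : ∀ B, MeasurableSet B →
    fderivWithin ℝ (fun ϑ => (P ϑ).real B) Θ θ φ = ∫ x in B, l x ∂(P θ)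

/-- `J` is the Fisher information operator at `θ` of the family `P`: all the `P_θ(B)` are Fréchet
differentiable, the logarithmic derivatives `l(φ)` exist and are square integrable in all
directions, and `(φ, J χ) = E_θ[l(φ) l(χ)]`. When `l(φ) = (κ, φ)` for a logarithmic gradient
`κ` with square integrable norm, this says `J = E_θ[κ κ*]`; see
`isFisherInfo_iff_of_logGradient`. -/
def IsFisherInfo (P : Ξ → Measure Ω) (Θ : Set Ξ) (θ : Ξ) (J : Ξ →L[ℝ] Ξ) : Prop :=
  (∀ B, MeasurableSet B → DifferentiableWithinAt ℝ (fun ϑ => (P ϑ).real B) Θ θ) ∧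
  ∃ l : Ξ → Ω → ℝ, (∀ φ, IsLogDeriv P Θ θ φ (l φ)) ∧ (∀ φ, MemLp (l φ) 2 (P θ)) ∧
    ∀ φ χ, ⟪φ, J χ⟫_ℝ = ∫ x, l φ x * l χ x ∂(P θ)

theorem IsLogDeriv.ae_eq {P : Ξ → Measure Ω} {Θ : Set Ξ} {θ φ : Ξ} {l l' : Ω → ℝ}
    (h : IsLogDeriv P Θ θ φ l) (h' : IsLogDeriv P Θ θ φ l') : l =ᵐ[P θ] l' :=
  h.integrable.ae_eq_of_forall_setIntegral_eq _ _ h'.integrable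
    fun B hB _ => (h.eqn B hB).symm.trans (h'.eqn B hB)

/-- If there is a logarithmic gradient `κ` with square integrable norm, then the Fisher information
operator is `E_θ[κ κ*]`. -/
theorem isFisherInfo_iff_of_logGradient [CompleteSpace Ξ] {P : Ξ → Measure Ω} {Θ : Set Ξ} {θ : Ξ}
    (hP : ∀ B, MeasurableSet B → DifferentiableWithinAt ℝ (fun ϑ => (P ϑ).real B) Θ θ)
    {κ : Ω → Ξ} (hκ : MemLp κ 2 (P θ)) (hl : ∀ φ, IsLogDeriv P Θ θ φ fun x => ⟪κ x, φ⟫_ℝ)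
    (J : Ξ →L[ℝ] Ξ) :
    IsFisherInfo P Θ θ J ↔ ∀ φ, J φ = ∫ x, ⟪κ x, φ⟫_ℝ • κ x ∂(P θ) := by
  have hm : ∀ φ, MemLp (fun x => ⟪κ x, φ⟫_ℝ) 2 (P θ) := fun φ => hκ.inner_const φ
  have hint : ∀ φ, Integrable (fun x => ⟪κ x, φ⟫_ℝ • κ x) (P θ) := fun φ =>
    memLp_one_iff_integrable.1 (hκ.smul (hm φ))
  have key : ∀ φ χ, ⟪φ, ∫ x, ⟪κ x, χ⟫_ℝ • κ x ∂(P θ)⟫_ℝ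
      = ∫ x, ⟪κ x, φ⟫_ℝ * ⟪κ x, χ⟫_ℝ ∂(P θ) := fun φ χ => by
    rw [← integral_inner (hint χ)]
    refine integral_congr_ae (Eventually.of_forall fun x => ?_)
    simp only [inner_smul_right, real_inner_comm φ, mul_comm]
  constructor
  · rintro ⟨-, l, h₁, -, h₃⟩ χ
    refine ext_inner_left ℝ fun φ => ?_
    rw [h₃, key]
    refine integral_congr_ae ?_
    filter_upwards [(h₁ φ).ae_eq (hl φ), (h₁ χ).ae_eq (hl χ)] with x e₁ e₂
    rw [e₁, e₂]
  · intro h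
    exact ⟨hP, fun φ x => ⟪κ x, φ⟫_ℝ, hl, hm, fun φ χ => by rw [h, key]⟩

end Classical

/-! ### Quantum statistical models and measurements -/

section Quantum

/-- A positive operator-valued measure on the measurable space `Ω` (only the values at measurable
sets matter). -/
structure POVM (Ω : Type*) [MeasurableSpace Ω] (H : Type*) [NormedAddCommGroup H]
    [InnerProductSpace ℂ H] where
  toFun : Set Ω → H →L[ℂ] H
  isPositive : ∀ B, MeasurableSet B → (toFun B).IsPositive
  map_univ : toFun Set.univ = 1
  hasSum_iUnion : ∀ B : ℕ → Set Ω, (∀ n, MeasurableSet (B n)) →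
    Pairwise (Function.onFun Disjoint B) →
    ∀ x y : H, HasSum (fun n => ⟪x, toFun (B n) y⟫_ℂ) ⟪x, toFun (⋃ n, B n) y⟫_ℂ

variable (H : Type*) [NormedAddCommGroup H] [InnerProductSpace ℂ H] [CompleteSpace H]
  (Ξ : Type*) [NormedAddCommGroup Ξ] [InnerProductSpace ℝ Ξ]

/-- A quantum statistical model: a family of strictly positive density operators `ρ(θ)`, `θ ∈ Θ`,
that is Fréchet differentiable for the trace norm, with derivative `D θ` at `θ ∈ Θ`. The
parameter set `Θ ⊆ Ξ` need not be open; it is only required that derivatives relative to `Θ` are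
unique. -/
structure Model where
  Θ : Set Ξ
  uniqueDiff : UniqueDiffOn ℝ Θ
  ρ : Ξ → H →L[ℂ] H
  isDensity : ∀ θ ∈ Θ, IsDensity (ρ θ)
  isStrictlyPos : ∀ θ ∈ Θ, IsStrictlyPos (ρ θ)
  D : Ξ → Ξ →ₗ[ℝ] (H →L[ℂ] H)
  hasDeriv : ∀ θ ∈ Θ, HasTraceFDerivWithinAt ρ (D θ) Θ θ

variable {H Ξ}

namespace Model

/-- `P` is the family of outcome distributions `P_θ(B) = Tr[ρ(θ) M(B)]`, `θ ∈ Θ`, of the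
measurement `M`. -/
def IsOutcomeLaw (S : Model H Ξ) {Ω : Type*} [MeasurableSpace Ω] (M : POVM Ω H)
    (P : Ξ → Measure Ω) : Prop :=
  ∀ θ ∈ S.Θ, IsProbabilityMeasure (P θ) ∧
    ∀ B, MeasurableSet B → ((P θ).real B : ℂ) = trace (S.ρ θ * M.toFun B)

/-- `J` is the Fisher information operator `J^M_θ` of the measurement `M`. -/
def IsMeasFisher (S : Model H Ξ) (θ : Ξ) {Ω : Type*} [MeasurableSpace Ω] (M : POVM Ω H)
    (J : Ξ →L[ℝ] Ξ) : Prop :=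
  ∃ P : Ξ → Measure Ω, S.IsOutcomeLaw M P ∧ IsFisherInfo P S.Θ θ J

/-- The model has symmetric logarithmic derivatives at `θ` in all directions. -/
def HasSLD (S : Model H Ξ) (θ : Ξ) : Prop := ∀ φ, ∃ A, IsSLD (S.ρ θ) (S.D θ φ) A

/-- The model has right logarithmic derivatives at `θ` in all directions. -/
def HasRLD (S : Model H Ξ) (θ : Ξ) : Prop := ∀ φ, ∃ Y, IsRLD (S.ρ θ) (S.D θ φ) Y

/-- `J` is the SLD Fisher information operator `J^S_θ`: `(φ, J χ) = Tr[K(L(φ))* L(χ)]` with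
`K(X) = (ρ X + X ρ) / 2` and `L` the symmetric logarithmic derivative. In terms of `A = L √ρ`
the right-hand side is `((A(φ), A(χ))_HS + (A(χ), A(φ))_HS) / 2 = Re (A(φ), A(χ))_HS`. -/
def IsSLDFisher (S : Model H Ξ) (θ : Ξ) (J : Ξ →L[ℝ] Ξ) : Prop :=
  ∃ A : Ξ → H →L[ℂ] H, (∀ φ, IsSLD (S.ρ θ) (S.D θ φ) (A φ)) ∧
    ∀ φ χ, ⟪φ, J χ⟫_ℝ = (hsInner (A φ) (A χ)).re

/-- `J` is the RLD Fisher information operator `J^R_θ` on the complexification of `Ξ`: its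
sesquilinear form is the sesquilinear extension of `h(φ, χ) = Tr[K(L(φ))* L(χ)]` with
`K(X) = ρ X` and `L` the right logarithmic derivative, that is `h(φ, χ) = (Y(φ), Y(χ))_HS` in
terms of `Y = √ρ L`. -/
def IsRLDFisher (S : Model H Ξ) (θ : Ξ) (J : Cx Ξ →L[ℂ] Cx Ξ) : Prop :=
  ∃ Y : Ξ → H →L[ℂ] H, (∀ φ, IsRLD (S.ρ θ) (S.D θ φ) (Y φ)) ∧
    ∀ φ χ : Cx Ξ, ⟪φ, J χ⟫_ℂ =
      hsInner (Y φ.re) (Y χ.re) + Complex.I * hsInner (Y φ.re) (Y χ.im)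
        - Complex.I * hsInner (Y φ.im) (Y χ.re) + hsInner (Y φ.im) (Y χ.im)

end Model

end Quantum

end QEst

end

noncomputable section

set_option linter.unusedSectionVars false

namespace QEst

/-! ### The Hilbert space of Hilbert–Schmidt operators -/

section HilbertSchmidt

variable {H : Type*} [NormedAddCommGroup H] [InnerProductSpace ℂ H] [CompleteSpace H]

/-! Write `s` for the square root of `ρ`, and `M(f)` for the sum of the `c M(f = c)` over the values
`c` of a simple function `f`. The inequalities rest on one estimate: the Kadison inequality `M(f)*
M(f) ≤ M(|f|²)`, evaluated in the state, says that the Hilbert–Schmidt norm of `M(f) s` is at most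
the `L²(P)` norm of `f` (`POVM.hsNorm_simpleInt_mul_sqrt_le`). If `d = s Y`, cyclicity of the trace
and Cauchy–Schwarz make `f ↦ Tr[d M(f)]` a functional on `L²(P)` of norm at most that of `Y`. Its
Riesz vector yields the logarithmic derivative together with the bound on its second moment
(`exists_density_of_bound`). The symmetric case averages two such estimates. The right case applies
the estimate to complex directions, which is why `f` and the densities are complex valued.

Strict positivity makes logarithmic derivatives unique, hence linear in the direction. The closed
graph theorem (`exists_hsCLM`) bounds them as maps `T` into the Hilbert–Schmidt space. The quantum
information operators are then `T* T`, and `J^M` is obtained in the same way from the bounded map `φ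
↦ l(φ)` into `L²(P)`.

For attainment one wants to measure the spectrum of the symmetric logarithmic derivative `L`, but
`L` is only symmetric and need not have a self-adjoint extension in `H`. Its Cayley transform `(A +
i s) x ↦ (A - i s) x` is isometric, and it dilates to a unitary `U` on `H ⊕ H`
(`exists_unitaryDilation`). The spectral measure of `U`, compressed to `H`, is the measurement. In
its spectral variable `s` and `A` act on `(A + i s) x` as multiplication by functions `g₀` and `g₁`
(`exists_diagonalizing_POVM`). The logarithmic derivative is `g₁ / g₀`, with second moment equal to
the squared Hilbert–Schmidt norm of `A`. -/

variable (H) in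
/-- The Hilbert space of square summable families indexed by the fixed Hilbert basis. -/
def HSSpace : Type _ := lp (fun _ : basisIndex H => H) 2

instance : NormedAddCommGroup (HSSpace H) :=
  inferInstanceAs (NormedAddCommGroup (lp (fun _ : basisIndex H => H) 2))

instance : InnerProductSpace ℂ (HSSpace H) :=
  inferInstanceAs (InnerProductSpace ℂ (lp (fun _ : basisIndex H => H) 2))

instance : CompleteSpace (HSSpace H) :=
  inferInstanceAs (CompleteSpace (lp (fun _ : basisIndex H => H) 2))

/-- The Hilbert–Schmidt norm. -/
def hsNorm (A : H →L[ℂ] H) : ℝ := √(∑' i, ‖A (stdBasis H i)‖ ^ 2)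

/-- The family of the values of a Hilbert–Schmidt operator on the basis. -/
def IsHilbertSchmidt.vec {A : H →L[ℂ] H} (hA : IsHilbertSchmidt A) : HSSpace H :=
  ⟨fun i => A (stdBasis H i), memℓp_gen (by simpa [IsHilbertSchmidt] using hA)⟩

variable {A B : H →L[ℂ] H}

theorem hsNorm_nonneg (A : H →L[ℂ] H) : 0 ≤ hsNorm A := Real.sqrt_nonneg _

theorem hsNorm_sq (A : H →L[ℂ] H) : hsNorm A ^ 2 = ∑' i, ‖A (stdBasis H i)‖ ^ 2 :=
  Real.sq_sqrt (tsum_nonneg fun _ => by positivity)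

theorem IsHilbertSchmidt.inner_vec (hA : IsHilbertSchmidt A) (hB : IsHilbertSchmidt B) :
    ⟪hA.vec, hB.vec⟫_ℂ = hsInner A B := rfl

theorem IsHilbertSchmidt.hasSum_inner (hA : IsHilbertSchmidt A) (hB : IsHilbertSchmidt B) :
    HasSum (fun i => ⟪A (stdBasis H i), B (stdBasis H i)⟫_ℂ) (hsInner A B) :=
  lp.hasSum_inner (𝕜 := ℂ) (G := fun _ : basisIndex H => H) hA.vec hB.vec

theorem IsHilbertSchmidt.norm_vec (hA : IsHilbertSchmidt A) : ‖hA.vec‖ = hsNorm A := by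
  have h := lp.norm_rpow_eq_tsum (p := 2) (E := fun _ : basisIndex H => H) (by simp) hA.vec
  rw [hsNorm, eq_comm, Real.sqrt_eq_iff_eq_sq (tsum_nonneg fun _ => by positivity) (norm_nonneg _)]
  simp only [ENNReal.toReal_ofNat, Real.rpow_ofNat] at h
  exact h.symm

theorem IsHilbertSchmidt.norm_hsInner_le (hA : IsHilbertSchmidt A) (hB : IsHilbertSchmidt B) :
    ‖hsInner A B‖ ≤ hsNorm A * hsNorm B := by
  rw [← hA.inner_vec hB, ← hA.norm_vec, ← hB.norm_vec]
  exact norm_inner_le_norm _ _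

theorem IsHilbertSchmidt.add (hA : IsHilbertSchmidt A) (hB : IsHilbertSchmidt B) :
    IsHilbertSchmidt (A + B) := by
  refine Summable.of_nonneg_of_le (fun _ => by positivity) (fun i => ?_)
    ((hA.mul_left 2).add (hB.mul_left 2))
  have h := norm_add_le (A (stdBasis H i)) (B (stdBasis H i))
  rw [add_apply]
  nlinarith [norm_nonneg (A (stdBasis H i) + B (stdBasis H i)),
    sq_nonneg (‖A (stdBasis H i)‖ - ‖B (stdBasis H i)‖)]

theorem IsHilbertSchmidt.mul_left (X : H →L[ℂ] H) (hA : IsHilbertSchmidt A) :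
    IsHilbertSchmidt (X * A) := by
  refine Summable.of_nonneg_of_le (fun _ => by positivity) (fun i => ?_)
    (Summable.mul_left (‖X‖ ^ 2) hA)
  rw [← mul_pow]
  exact pow_le_pow_left₀ (norm_nonneg _) (X.le_opNorm _) 2

theorem hsNorm_mul_left_le (X : H →L[ℂ] H) (hA : IsHilbertSchmidt A) :
    hsNorm (X * A) ≤ ‖X‖ * hsNorm A := by
  refine le_of_sq_le_sq ?_ (mul_nonneg (norm_nonneg _) (hsNorm_nonneg _))
  rw [mul_pow, hsNorm_sq, hsNorm_sq, ← tsum_mul_left]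
  refine (hA.mul_left X).tsum_le_tsum (fun i => ?_) (Summable.mul_left (‖X‖ ^ 2) hA)
  rw [← mul_pow]
  exact pow_le_pow_left₀ (norm_nonneg _) (X.le_opNorm _) 2

theorem IsHilbertSchmidt.const_smul (c : ℂ) (hA : IsHilbertSchmidt A) :
    IsHilbertSchmidt (c • A) := by
  simpa using hA.mul_left (c • (1 : H →L[ℂ] H))

theorem IsHilbertSchmidt.const_smul_real (c : ℝ) (hA : IsHilbertSchmidt A) :
    IsHilbertSchmidt (c • A) :=
  hA.const_smul (c : ℂ)

theorem hasSum_norm_inner_basis_sq (x : H) :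
    HasSum (fun i => ‖⟪stdBasis H i, x⟫_ℂ‖ ^ 2) (‖x‖ ^ 2) := by
  have h := (stdBasis H).hasSum_inner_mul_inner x x
  have h2 := Complex.hasSum_re h
  convert h2 using 1
  · ext i
    rw [← inner_conj_symm x (stdBasis H i), mul_comm, Complex.mul_conj, Complex.normSq_eq_norm_sq,
      Complex.ofReal_re]
  · exact (inner_self_eq_norm_sq (𝕜 := ℂ) x).symm

theorem inner_star_apply (A : H →L[ℂ] H) (x y : H) : ⟪star A x, y⟫_ℂ = ⟪x, A y⟫_ℂ := by
  rw [ContinuousLinearMap.star_eq_adjoint, ContinuousLinearMap.adjoint_inner_left]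

theorem inner_apply_star (A : H →L[ℂ] H) (x y : H) : ⟪x, star A y⟫_ℂ = ⟪A x, y⟫_ℂ := by
  rw [ContinuousLinearMap.star_eq_adjoint, ContinuousLinearMap.adjoint_inner_right]

theorem IsHilbertSchmidt.summable_matrix (hA : IsHilbertSchmidt A) :
    Summable fun p : basisIndex H × basisIndex H =>
      ‖⟪stdBasis H p.2, A (stdBasis H p.1)⟫_ℂ‖ ^ 2 := by
  rw [summable_prod_of_nonneg (fun _ => sq_nonneg _)]
  refine ⟨fun i => (hasSum_norm_inner_basis_sq (A (stdBasis H i))).summable, ?_⟩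
  exact Summable.congr hA fun i =>
    (hasSum_norm_inner_basis_sq (A (stdBasis H i))).tsum_eq.symm

/-- Both sums of squares equal the sum of the squared moduli of all matrix entries, taken by columns
or by rows. -/
theorem IsHilbertSchmidt.star (hA : IsHilbertSchmidt A) : IsHilbertSchmidt (star A) := by
  have h := hA.summable_matrix.prod_symm
  rw [summable_prod_of_nonneg (fun _ => sq_nonneg _)] at h
  refine h.2.congr fun j => ?_
  rw [← (hasSum_norm_inner_basis_sq _).tsum_eq]
  refine tsum_congr fun i => ?_
  rw [inner_apply_star, norm_inner_symm]
  rfl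

/-- Expanding by Parseval gives a double series that converges absolutely, since `|ab| ≤ |a|² +
|b|²`; interchanging the summations exchanges the two sides. -/
theorem hsInner_star (hA : IsHilbertSchmidt A) (hB : IsHilbertSchmidt B) :
    hsInner (star A) (star B) = hsInner B A := by
  have hs : Summable (Function.uncurry fun i j : basisIndex H =>
      ⟪B (stdBasis H i), stdBasis H j⟫_ℂ * ⟪stdBasis H j, A (stdBasis H i)⟫_ℂ) := by
    refine Summable.of_norm_bounded (hA.summable_matrix.add hB.summable_matrix) fun p => ?_
    simp only [Function.uncurry, norm_mul, norm_inner_symm (B _)]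
    nlinarith [sq_nonneg (‖⟪stdBasis H p.2, A (stdBasis H p.1)⟫_ℂ‖ -
      ‖⟪stdBasis H p.2, B (stdBasis H p.1)⟫_ℂ‖), sq_nonneg ‖⟪stdBasis H p.2, A (stdBasis H p.1)⟫_ℂ‖,
      sq_nonneg ‖⟪stdBasis H p.2, B (stdBasis H p.1)⟫_ℂ‖]
  have h := hs.tsum_comm
  simp only [(stdBasis H).tsum_inner_mul_inner] at h
  rw [hsInner, hsInner, ← h]
  refine tsum_congr fun j => ?_
  rw [← (stdBasis H).tsum_inner_mul_inner]
  refine tsum_congr fun i => ?_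
  rw [inner_star_apply, inner_apply_star, mul_comm]

theorem hsInner_self (hA : IsHilbertSchmidt A) : hsInner A A = ((hsNorm A ^ 2 : ℝ) : ℂ) := by
  rw [← hA.inner_vec hA, inner_self_eq_norm_sq_to_K, hA.norm_vec]; simp

theorem hsNorm_star (hA : IsHilbertSchmidt A) : hsNorm (star A) = hsNorm A := by
  have h := hsInner_star hA hA
  rw [hsInner_self hA, hsInner_self hA.star, Complex.ofReal_inj] at h
  exact (sq_eq_sq₀ (hsNorm_nonneg _) (hsNorm_nonneg _)).1 h

theorem IsHilbertSchmidt.mul_right (X : H →L[ℂ] H) (hA : IsHilbertSchmidt A) :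
    IsHilbertSchmidt (A * X) := by
  simpa using (hA.star.mul_left (Star.star X)).star

theorem hsNorm_mul_right_le (X : H →L[ℂ] H) (hA : IsHilbertSchmidt A) :
    hsNorm (A * X) ≤ hsNorm A * ‖X‖ := by
  have h := hsNorm_mul_left_le (star X) hA.star
  rw [← star_mul, hsNorm_star (hA.mul_right X), hsNorm_star hA, norm_star] at h
  rwa [mul_comm]

/-- Parseval for `A* y`, with Cauchy–Schwarz in each coordinate `⟪A eᵢ, y⟫`. -/
theorem IsHilbertSchmidt.norm_le (hA : IsHilbertSchmidt A) : ‖A‖ ≤ hsNorm A := by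
  rw [← norm_star A]
  refine ContinuousLinearMap.opNorm_le_bound _ (hsNorm_nonneg _) fun y => ?_
  refine le_of_sq_le_sq ?_ (mul_nonneg (hsNorm_nonneg _) (norm_nonneg _))
  rw [mul_pow, hsNorm_sq, ← tsum_mul_right, ← (hasSum_norm_inner_basis_sq _).tsum_eq]
  refine (hasSum_norm_inner_basis_sq _).summable.tsum_le_tsum (fun i => ?_)
    (Summable.mul_right (‖y‖ ^ 2) hA)
  rw [inner_apply_star, ← mul_pow]
  exact pow_le_pow_left₀ (norm_nonneg _) (norm_inner_le_norm _ _) 2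

theorem trace_mul_eq_hsInner (A B : H →L[ℂ] H) : trace (A * B) = hsInner (star A) B :=
  tsum_congr fun i => by rw [inner_star_apply]; rfl

theorem hasSum_trace_mul (hA : IsHilbertSchmidt A) (hB : IsHilbertSchmidt B) :
    HasSum (fun i => ⟪stdBasis H i, (A * B) (stdBasis H i)⟫_ℂ) (trace (A * B)) := by
  rw [trace_mul_eq_hsInner]
  convert hA.star.hasSum_inner hB using 2 with i
  rw [inner_star_apply]; rfl

/-- Cyclicity is the behaviour of the Hilbert–Schmidt inner product under adjoints. -/
theorem trace_mul_comm (hA : IsHilbertSchmidt A) (hB : IsHilbertSchmidt B) :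
    trace (A * B) = trace (B * A) := by
  rw [trace_mul_eq_hsInner, trace_mul_eq_hsInner, ← hsInner_star hA hB.star, star_star]

theorem norm_trace_mul_le (hA : IsHilbertSchmidt A) (hB : IsHilbertSchmidt B) :
    ‖trace (A * B)‖ ≤ hsNorm A * hsNorm B := by
  rw [trace_mul_eq_hsInner, ← hsNorm_star hA]
  exact hA.star.norm_hsInner_le hB

end HilbertSchmidt

/-! ### Partial isometries, polar decomposition and the trace norm -/

section TraceNorm

variable {H : Type*} [NormedAddCommGroup H] [InnerProductSpace ℂ H] [CompleteSpace H]

/-- If `‖F x‖ = ‖G x‖` for all `x`, then `F = C G` for a partial isometry `C` with initial space the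
closure of the range of `G`. -/
theorem exists_partialIsometry {F G : H →L[ℂ] H} (h : ∀ x, ‖F x‖ = ‖G x‖) :
    ∃ C : H →L[ℂ] H, C * G = F ∧ C * (star C * C) = C ∧ star C * C * G = G ∧ ‖C‖ ≤ 1 := by
  set S : Submodule ℂ H := (LinearMap.range (G : H →ₗ[ℂ] H)).topologicalClosure with hS
  have hmem : ∀ x, G x ∈ S := fun x => Submodule.le_topologicalClosure _ ⟨x, rfl⟩
  let e : H →ₗ[ℂ] S := (G : H →ₗ[ℂ] H).codRestrict S hmem
  have hd : DenseRange e := by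
    intro y
    rw [closure_subtype]
    have : ((↑) : S → H) '' Set.range e = LinearMap.range (G : H →ₗ[ℂ] H) := by
      ext z; simp [e]
    rw [this]
    exact y.2
  have hn : ∀ x, ‖(F : H →ₗ[ℂ] H) x‖ ≤ 1 * ‖e x‖ := fun x => by
    rw [one_mul]; exact (h x).le
  -- `G x ↦ F x` is well defined and isometric on the range of `G`, so it extends to the closure
  -- `S`; `C` is this extension after the projection onto `S`.
  let V₀ : S →L[ℂ] H := (F : H →ₗ[ℂ] H).extendOfNorm e
  have hV₀ : ∀ x, V₀ (e x) = F x := LinearMap.extendOfNorm_eq hd ⟨1, hn⟩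
  have hiso : ∀ y, ‖V₀ y‖ = ‖y‖ := by
    refine fun y => hd.induction_on (p := fun y => ‖V₀ y‖ = ‖y‖) y ?_ fun x => ?_
    · exact isClosed_eq V₀.continuous.norm continuous_norm
    · rw [hV₀]; exact h x
  let V : S →ₗᵢ[ℂ] H := ⟨V₀, hiso⟩
  have hV : ∀ y, V y = V₀ y := fun _ => rfl
  let C : H →L[ℂ] H := V₀ ∘L S.orthogonalProjectionOnto
  have hC : ∀ x, C x = V₀ (S.orthogonalProjectionOnto x) := fun _ => rfl
  have hP : star C * C = S.starProjection := by
    ext x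
    refine ext_inner_left ℂ fun y => ?_
    rw [mul_apply_eq_comp, inner_apply_star, hC, hC, ← hV, ← hV, V.inner_map_map,
      Submodule.starProjection_apply, Submodule.coe_inner,
      Submodule.coe_orthogonalProjectionOnto_apply, Submodule.coe_orthogonalProjectionOnto_apply,
      Submodule.inner_starProjection_left_eq_right, ← mul_apply_eq_comp,
      (Submodule.isIdempotentElem_starProjection S).eq]
  refine ⟨C, ?_, ?_, ?_, ?_⟩
  · ext x
    have : S.orthogonalProjectionOnto (G x) = e x :=
      Submodule.orthogonalProjectionOnto_mem_subspace_eq_self (e x)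
    rw [mul_apply_eq_comp, hC, this, hV₀]
  · rw [hP]
    ext x
    have : S.orthogonalProjectionOnto (S.starProjection x) = S.orthogonalProjectionOnto x :=
      Submodule.orthogonalProjectionOnto_mem_subspace_eq_self (S.orthogonalProjectionOnto x)
    rw [mul_apply_eq_comp, hC, hC, this]
  · rw [hP]
    ext x
    exact Submodule.starProjection_eq_self_iff.2 (hmem x)
  · refine ContinuousLinearMap.opNorm_le_bound _ zero_le_one fun x => ?_
    rw [hC, hiso, one_mul]
    exact Submodule.norm_orthogonalProjectionOnto_apply_le S x

theorem norm_sqrt_apply_sq {r : H →L[ℂ] H} (hr : 0 ≤ r) (x : H) :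
    ‖CFC.sqrt r x‖ ^ 2 = (⟪x, r x⟫_ℂ).re := by
  have hs : star (CFC.sqrt r) = CFC.sqrt r := (CFC.sqrt_nonneg r).isSelfAdjoint.star_eq
  have h3 : r x = star (CFC.sqrt r) (CFC.sqrt r x) := by
    rw [hs]
    exact congrArg (fun T : H →L[ℂ] H => T x) (CFC.sqrt_mul_sqrt_self r hr).symm
  rw [h3, inner_apply_star]
  exact norm_sq_eq_re_inner (𝕜 := ℂ) _

/-- A trace class operator is the product of two Hilbert–Schmidt operators. -/
theorem IsTraceClass.exists_factor {T : H →L[ℂ] H} (hT : IsTraceClass T) :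
    ∃ R S : H →L[ℂ] H, IsHilbertSchmidt R ∧ IsHilbertSchmidt S ∧ R * S = T ∧
      hsNorm R * hsNorm S ≤ (traceNorm T).toReal := by
  have h0 : 0 ≤ star T * T := star_mul_self_nonneg T
  set a := CFC.sqrt (star T * T) with ha
  have ha0 : 0 ≤ a := CFC.sqrt_nonneg _
  set q := CFC.sqrt a with hq
  have hq2 : ∀ x, ‖q x‖ ^ 2 = (⟪x, a x⟫_ℂ).re := norm_sqrt_apply_sq ha0
  have hqHS : IsHilbertSchmidt q := by
    unfold IsHilbertSchmidt
    simp only [hq2]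
    refine (ENNReal.summable_toReal hT.ne).congr fun i => ?_
    rw [ENNReal.toReal_ofReal]
    rw [← hq2]; positivity
  have hqn : hsNorm q ^ 2 = (traceNorm T).toReal := by
    rw [hsNorm_sq, traceNorm, ENNReal.tsum_toReal_eq fun i => ENNReal.ofReal_ne_top]
    refine tsum_congr fun i => ?_
    rw [hq2, ENNReal.toReal_ofReal]
    rw [← hq2]; positivity
  -- Polar decomposition `T = W a` with `a = |T|`; the two factors are `W √a` and `√a`, and the
  -- squared Hilbert–Schmidt norm of `√a` is the trace norm of `T`.
  obtain ⟨W, hW, -, -, hW1⟩ := exists_partialIsometry (F := T) (G := a) fun x => by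
    refine (sq_eq_sq₀ (norm_nonneg _) (norm_nonneg _)).1 ?_
    rw [ha, norm_sqrt_apply_sq h0, mul_apply_eq_comp, inner_apply_star]
    exact norm_sq_eq_re_inner (𝕜 := ℂ) _
  refine ⟨W * q, q, hqHS.mul_left W, hqHS, ?_, ?_⟩
  · rw [mul_assoc, CFC.sqrt_mul_sqrt_self a ha0, hW]
  · rw [← hqn, sq]
    refine mul_le_mul_of_nonneg_right ?_ (hsNorm_nonneg _)
    refine (hsNorm_mul_left_le W hqHS).trans ?_
    exact mul_le_of_le_one_left (hsNorm_nonneg _) hW1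

theorem IsTraceClass.norm_le {T : H →L[ℂ] H} (hT : IsTraceClass T) :
    ‖T‖ ≤ (traceNorm T).toReal := by
  obtain ⟨R, S, hR, hS, rfl, h⟩ := hT.exists_factor
  exact (norm_mul_le _ _).trans
    ((mul_le_mul hR.norm_le hS.norm_le (norm_nonneg _) (hsNorm_nonneg _)).trans h)

/-- Factor `T = R S` into Hilbert–Schmidt operators and pair `R` with `S X`. This duality carries
trace norm differentiability over to outcome probabilities. -/
theorem IsTraceClass.norm_trace_mul_le {T : H →L[ℂ] H} (hT : IsTraceClass T) (X : H →L[ℂ] H) :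
    ‖trace (T * X)‖ ≤ (traceNorm T).toReal * ‖X‖ := by
  obtain ⟨R, S, hR, hS, rfl, h⟩ := hT.exists_factor
  rw [mul_assoc]
  refine (QEst.norm_trace_mul_le hR (hS.mul_right X)).trans ?_
  refine (mul_le_mul_of_nonneg_left (hsNorm_mul_right_le X hS) (hsNorm_nonneg _)).trans ?_
  rw [← mul_assoc]
  exact mul_le_mul_of_nonneg_right h (norm_nonneg _)

/-- The diagonal of `T` is summable. -/
def DiagSummable (T : H →L[ℂ] H) : Prop :=
  Summable fun i => ⟪stdBasis H i, T (stdBasis H i)⟫_ℂ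

theorem IsHilbertSchmidt.diagSummable_mul {A B : H →L[ℂ] H} (hA : IsHilbertSchmidt A)
    (hB : IsHilbertSchmidt B) : DiagSummable (A * B) := (hasSum_trace_mul hA hB).summable

theorem IsTraceClass.diagSummable_mul {T : H →L[ℂ] H} (hT : IsTraceClass T) (X : H →L[ℂ] H) :
    DiagSummable (T * X) := by
  obtain ⟨R, S, hR, hS, rfl, h⟩ := hT.exists_factor
  rw [mul_assoc]
  exact hR.diagSummable_mul (hS.mul_right X)

theorem trace_add {S T : H →L[ℂ] H} (hS : DiagSummable S) (hT : DiagSummable T) :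
    trace (S + T) = trace S + trace T := by
  rw [trace, trace, trace, ← Summable.tsum_add hS hT]
  exact tsum_congr fun i => by rw [add_apply, inner_add_right]

theorem trace_sub {S T : H →L[ℂ] H} (hS : DiagSummable S) (hT : DiagSummable T) :
    trace (S - T) = trace S - trace T := by
  rw [trace, trace, trace, ← Summable.tsum_sub hS hT]
  exact tsum_congr fun i => by rw [sub_apply, inner_sub_right]

theorem trace_smul (c : ℂ) (T : H →L[ℂ] H) : trace (c • T) = c * trace T := by
  rw [trace, trace, ← tsum_mul_left]
  exact tsum_congr fun i => by rw [smul_apply, inner_smul_right]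

theorem trace_star (T : H →L[ℂ] H) : trace (star T) = star (trace T) := by
  rw [trace, trace, Complex.star_def, Complex.conj_tsum]
  exact tsum_congr fun i => by rw [inner_apply_star, inner_conj_symm]

end TraceNorm

/-! ### Positive operator-valued measures -/

section PositiveOperatorMeasure

variable {H : Type*} [NormedAddCommGroup H] [InnerProductSpace ℂ H] [CompleteSpace H]
  {Ω : Type*} [MeasurableSpace Ω]

theorem isPositive_inner_eq {T : H →L[ℂ] H} (hT : T.IsPositive) (x : H) :
    (((⟪x, T x⟫_ℂ).re : ℝ) : ℂ) = ⟪x, T x⟫_ℂ := by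
  have := hT.inner_nonneg_right x
  exact (Complex.eq_re_of_ofReal_le this).symm

theorem isPositive_inner_re_nonneg {T : H →L[ℂ] H} (hT : T.IsPositive) (x : H) :
    0 ≤ (⟪x, T x⟫_ℂ).re := hT.re_inner_nonneg_right x

theorem eq_of_forall_inner_self_eq {S T : H →L[ℂ] H} (h : ∀ x, ⟪x, S x⟫_ℂ = ⟪x, T x⟫_ℂ) :
    S = T := by
  have : (S : H →ₗ[ℂ] H) = T := (ext_inner_map (S : H →ₗ[ℂ] H) T).1 fun x => by
    have := congrArg (starRingEnd ℂ) (h x)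
    rwa [inner_conj_symm, inner_conj_symm] at this
  exact ContinuousLinearMap.coe_injective this

namespace POVM

variable (M : POVM Ω H)

/-- Countable additivity for the constant sequence `∅`: a summable constant sequence of complex
numbers vanishes. -/
theorem map_empty : M.toFun ∅ = 0 := by
  refine eq_of_forall_inner_self_eq fun x => ?_
  have h := M.hasSum_iUnion (fun _ => ∅) (fun _ => MeasurableSet.empty)
    (fun _ _ _ => by simp [Function.onFun]) x x
  rw [Set.iUnion_empty] at h
  simpa using (summable_const_iff _).1 h.summable

/-- The measure `B ↦ ⟪x, M(B) x⟫`. -/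
def measure (x : H) : Measure Ω :=
  Measure.ofMeasurable (fun B _ => ENNReal.ofReal (⟪x, M.toFun B x⟫_ℂ).re)
    (by simp [M.map_empty])
    (fun B hB hd => by
      have h := Complex.hasSum_re (M.hasSum_iUnion B hB hd x x)
      rw [← h.tsum_eq, ENNReal.ofReal_tsum_of_nonneg
        (fun n => isPositive_inner_re_nonneg (M.isPositive _ (hB n)) x) h.summable])

theorem measure_apply (x : H) {B : Set Ω} (hB : MeasurableSet B) :
    M.measure x B = ENNReal.ofReal (⟪x, M.toFun B x⟫_ℂ).re :=
  Measure.ofMeasurable_apply B hB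

instance (x : H) : IsFiniteMeasure (M.measure x) :=
  ⟨by rw [M.measure_apply x MeasurableSet.univ]; exact ENNReal.ofReal_lt_top⟩

theorem measure_real (x : H) {B : Set Ω} (hB : MeasurableSet B) :
    (M.measure x).real B = (⟪x, M.toFun B x⟫_ℂ).re := by
  rw [measureReal_def, M.measure_apply x hB, ENNReal.toReal_ofReal
    (isPositive_inner_re_nonneg (M.isPositive _ hB) x)]

theorem ofReal_measure_real (x : H) {B : Set Ω} (hB : MeasurableSet B) :
    ((M.measure x).real B : ℂ) = ⟪x, M.toFun B x⟫_ℂ := by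
  rw [M.measure_real x hB, isPositive_inner_eq (M.isPositive _ hB)]

theorem map_union {B C : Set Ω} (hB : MeasurableSet B) (hC : MeasurableSet C)
    (hd : Disjoint B C) : M.toFun (B ∪ C) = M.toFun B + M.toFun C := by
  refine eq_of_forall_inner_self_eq fun x => ?_
  rw [add_apply, inner_add_right, ← M.ofReal_measure_real x hB, ← M.ofReal_measure_real x hC,
    ← M.ofReal_measure_real x (hB.union hC), measureReal_union hd hC, Complex.ofReal_add]

/-- The operator `∫ g ∘ f dM` for a simple function `f`. -/
def simpleInt (f : SimpleFunc Ω ℂ) (g : ℂ → ℂ) : H →L[ℂ] H :=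
  ∑ c ∈ f.range, g c • M.toFun (f ⁻¹' {c})

theorem sum_measure_preimage (f : SimpleFunc Ω ℂ) (x : H) :
    ∑ c ∈ f.range, (⟪x, M.toFun (f ⁻¹' {c}) x⟫_ℂ).re = ‖x‖ ^ 2 := by
  have h : ∀ c ∈ f.range, (⟪x, M.toFun (f ⁻¹' {c}) x⟫_ℂ).re = (M.measure x).real (f ⁻¹' {c}) :=
    fun c _ => (M.measure_real x (f.measurableSet_preimage _)).symm
  rw [Finset.sum_congr rfl h, ← measureReal_biUnion_finset
    (fun c _ d _ hcd => (Set.disjoint_singleton.2 hcd).preimage f)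
    (fun c _ => f.measurableSet_preimage _)]
  have h2 : ⋃ c ∈ f.range, f ⁻¹' {c} = Set.univ :=
    Set.eq_univ_of_forall fun ω => Set.mem_biUnion (f.mem_range_self ω) rfl
  rw [h2, M.measure_real x MeasurableSet.univ, M.map_univ]
  exact inner_self_eq_norm_sq (𝕜 := ℂ) x

/-- The Kadison inequality for simple functions. -/
theorem norm_simpleInt_apply_sq_le (f : SimpleFunc Ω ℂ) (g : ℂ → ℂ) (x : H) :
    ‖M.simpleInt f g x‖ ^ 2 ≤ ∑ c ∈ f.range, ‖g c‖ ^ 2 * (⟪x, M.toFun (f ⁻¹' {c}) x⟫_ℂ).re := by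
  have h0 : ∀ c, 0 ≤ M.toFun (f ⁻¹' {c}) := fun c =>
    (ContinuousLinearMap.nonneg_iff_isPositive _).2 (M.isPositive _ (f.measurableSet_preimage _))
  set a : ℂ → H →L[ℂ] H := fun c => CFC.sqrt (M.toFun (f ⁻¹' {c})) with ha
  have ha2 : ∀ c z, (⟪z, M.toFun (f ⁻¹' {c}) z⟫_ℂ).re = ‖a c z‖ ^ 2 := fun c z =>
    (norm_sqrt_apply_sq (h0 c) z).symm
  set y := M.simpleInt f g x with hy
  have h1 : ∀ c, ‖⟪y, g c • M.toFun (f ⁻¹' {c}) x⟫_ℂ‖ ≤ ‖a c y‖ * (‖g c‖ * ‖a c x‖) := fun c => by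
    have hs : star (a c) = a c := (CFC.sqrt_nonneg _).isSelfAdjoint.star_eq
    have : M.toFun (f ⁻¹' {c}) x = star (a c) (a c x) := by
      rw [hs]
      exact congrArg (fun T : H →L[ℂ] H => T x) (CFC.sqrt_mul_sqrt_self _ (h0 c)).symm
    rw [inner_smul_right, this, inner_apply_star, norm_mul, mul_left_comm]
    exact mul_le_mul_of_nonneg_left (norm_inner_le_norm _ _) (norm_nonneg _)
  -- Pair `y = M(g ∘ f) x` with itself and split each effect as the square of `a c`. After
  -- Cauchy–Schwarz the factor `∑ ‖a c y‖²` is `‖y‖²`, because the effects sum to the identity, and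
  -- it cancels.
  have h2 : ‖y‖ ^ 2 ≤ ∑ c ∈ f.range, ‖a c y‖ * (‖g c‖ * ‖a c x‖) := by
    have h5 : ⟪y, y⟫_ℂ = ∑ c ∈ f.range, ⟪y, g c • M.toFun (f ⁻¹' {c}) x⟫_ℂ := by
      have : ⟪y, y⟫_ℂ = ⟪y, (∑ c ∈ f.range, g c • M.toFun (f ⁻¹' {c})) x⟫_ℂ := rfl
      rw [this, sum_apply, inner_sum]
      rfl
    rw [← inner_self_eq_norm_sq (𝕜 := ℂ) y]
    refine (Complex.re_le_norm _).trans ?_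
    rw [h5]
    refine (norm_sum_le _ _).trans (Finset.sum_le_sum fun c _ => ?_)
    exact h1 c
  have h3 := Finset.sum_mul_sq_le_sq_mul_sq f.range (fun c => ‖a c y‖) (fun c => ‖g c‖ * ‖a c x‖)
  have h4 : ∑ c ∈ f.range, ‖a c y‖ ^ 2 = ‖y‖ ^ 2 := by
    rw [← M.sum_measure_preimage f y]
    exact Finset.sum_congr rfl fun c _ => (ha2 c y).symm
  simp only [ha2]
  simp only [mul_pow, h4] at h3
  have hQ : 0 ≤ ∑ c ∈ f.range, ‖g c‖ ^ 2 * ‖a c x‖ ^ 2 := Finset.sum_nonneg fun _ _ => by positivity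
  rcases (sq_nonneg ‖y‖).eq_or_lt with h | h
  · rw [← h]; exact hQ
  · have h5 := (pow_le_pow_left₀ h.le h2 2).trans h3
    rw [sq (‖y‖ ^ 2)] at h5
    exact le_of_mul_le_mul_left h5 h

/-- The outcome distribution of the measurement `M` in the state `r`. -/
def law (r : H →L[ℂ] H) : Measure Ω :=
  Measure.sum fun i => M.measure (CFC.sqrt r (stdBasis H i))

/-- `Tr[r X] = Tr[√r X √r]` by cyclicity. In this form the diagonal terms are values of the
quadratic form of `X`, nonnegative for an effect, so the outcome law is a sum of positive measures.
-/
theorem hasSum_trace_density {r : H →L[ℂ] H} (hr : IsDensity r) (X : H →L[ℂ] H) :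
    HasSum (fun i => ⟪CFC.sqrt r (stdBasis H i), X (CFC.sqrt r (stdBasis H i))⟫_ℂ)
      (trace (r * X)) := by
  have hs : star (CFC.sqrt r) = CFC.sqrt r := (CFC.sqrt_nonneg r).isSelfAdjoint.star_eq
  have hHS := hr.isHilbertSchmidt_sqrt
  have h := hasSum_trace_mul (hHS.mul_right X) hHS
  rw [trace_mul_comm (hHS.mul_right X) hHS, ← mul_assoc, hr.sqrt_mul_sqrt] at h
  refine h.congr_fun ?_
  intro i
  rw [mul_apply_eq_comp, mul_apply_eq_comp, ← inner_star_apply (CFC.sqrt r), hs]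

theorem hasSum_law {r : H →L[ℂ] H} (hr : IsDensity r) {B : Set Ω} (hB : MeasurableSet B) :
    HasSum (fun i => (M.measure (CFC.sqrt r (stdBasis H i))).real B)
      (trace (r * M.toFun B)).re := by
  refine (Complex.hasSum_re (hasSum_trace_density hr (M.toFun B))).congr_fun fun i => ?_
  rw [M.measure_real _ hB]

theorem law_apply {r : H →L[ℂ] H} (hr : IsDensity r) {B : Set Ω} (hB : MeasurableSet B) :
    M.law r B = ENNReal.ofReal (trace (r * M.toFun B)).re := by
  have h := M.hasSum_law hr hB
  rw [law, Measure.sum_apply _ hB, ← h.tsum_eq,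
    ENNReal.ofReal_tsum_of_nonneg (fun _ => measureReal_nonneg) h.summable]
  exact tsum_congr fun i => (ofReal_measureReal).symm

theorem law_real {r : H →L[ℂ] H} (hr : IsDensity r) {B : Set Ω} (hB : MeasurableSet B) :
    ((M.law r).real B : ℂ) = trace (r * M.toFun B) := by
  have h := M.hasSum_law hr hB
  rw [measureReal_def, M.law_apply hr hB, ENNReal.toReal_ofReal
    (h.nonneg fun _ => measureReal_nonneg)]
  have h2 := hasSum_trace_density hr (M.toFun B)
  have h3 := Complex.hasSum_ofReal.2 h
  refine h3.unique (h2.congr_fun fun i => ?_)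
  rw [M.ofReal_measure_real _ hB]

theorem isProbabilityMeasure_law {r : H →L[ℂ] H} (hr : IsDensity r) :
    IsProbabilityMeasure (M.law r) :=
  ⟨by rw [M.law_apply hr MeasurableSet.univ, M.map_univ, mul_one, hr.trace_eq_one]; simp⟩

/-- Sum the Kadison inequality over the vectors `√r eᵢ`. The function `g` will be the identity or
complex conjugation, the latter giving the adjoint of `M(f)`. -/
theorem hsNorm_simpleInt_mul_sqrt_le {r : H →L[ℂ] H} (hr : IsDensity r) {P : Measure Ω}
    [IsFiniteMeasure P]
    (hP : ∀ B, MeasurableSet B → (P.real B : ℂ) = trace (r * M.toFun B)) (f : SimpleFunc Ω ℂ)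
    {g : ℂ → ℂ} (hg : ∀ c, ‖g c‖ = ‖c‖) :
    hsNorm (M.simpleInt f g * CFC.sqrt r) ^ 2 ≤ ∫ ω, ‖f ω‖ ^ 2 ∂P := by
  have hHS := hr.isHilbertSchmidt_sqrt
  have hf : Integrable f P := f.integrable_of_isFiniteMeasure
  have h1 : ∫ ω, ‖f ω‖ ^ 2 ∂P = ∑ c ∈ f.range, ‖c‖ ^ 2 * P.real (f ⁻¹' {c}) := by
    have h := SimpleFunc.map_integral f (fun c : ℂ => ‖c‖ ^ 2) hf (by simp)
    rw [SimpleFunc.integral_eq_integral _ (SimpleFunc.integrable_of_isFiniteMeasure _)] at h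
    simpa [mul_comm] using h
  have h2 : HasSum (fun i => ∑ c ∈ f.range, ‖c‖ ^ 2 * (⟪CFC.sqrt r (stdBasis H i),
      M.toFun (f ⁻¹' {c}) (CFC.sqrt r (stdBasis H i))⟫_ℂ).re) (∫ ω, ‖f ω‖ ^ 2 ∂P) := by
    rw [h1]
    refine hasSum_sum fun c _ => HasSum.mul_left _ ?_
    have h3 := Complex.hasSum_re (hasSum_trace_density hr (M.toFun (f ⁻¹' {c})))
    rwa [← hP _ (f.measurableSet_preimage _), Complex.ofReal_re] at h3
  rw [hsNorm_sq, ← h2.tsum_eq]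
  exact Summable.tsum_le_tsum (fun i => by
    simpa only [hg, mul_apply_eq_comp] using
      M.norm_simpleInt_apply_sq_le f g (CFC.sqrt r (stdBasis H i)))
    (hHS.mul_left (M.simpleInt f g)) h2.summable

theorem star_simpleInt (f : SimpleFunc Ω ℂ) :
    star (M.simpleInt f id) = M.simpleInt f (starRingEnd ℂ) := by
  rw [simpleInt, simpleInt, star_sum]
  refine Finset.sum_congr rfl fun c _ => ?_
  rw [star_smul, (M.isPositive _ (f.measurableSet_preimage _)).isSelfAdjoint.star_eq]
  rfl

end POVM

end PositiveOperatorMeasure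

/-! ### Densities of finitely additive set functions dominated in `L²` -/

section Density

variable {Ω : Type*} [MeasurableSpace Ω]

theorem norm_toLp_two_sq {P : Measure Ω} {f : Ω → ℂ} (hf : MemLp f 2 P) :
    ‖hf.toLp f‖ ^ 2 = ∫ ω, ‖f ω‖ ^ 2 ∂P := by
  have h := norm_sq_eq_re_inner (𝕜 := ℂ) (hf.toLp f)
  rw [L2.inner_def, ← integral_re (L2.integrable_inner _ _)] at h
  rw [h]
  refine integral_congr_ae ?_
  filter_upwards [hf.coeFn_toLp] with ω hω
  rw [hω]
  exact inner_self_eq_norm_sq (𝕜 := ℂ) _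

/-- A finitely additive set function which defines a functional bounded for the norm of `L²(P)` has
a square integrable density. -/
theorem exists_density_of_bound {P : Measure Ω} [IsFiniteMeasure P] {ν : Set Ω → ℂ}
    (hadd : ∀ B C, MeasurableSet B → MeasurableSet C → Disjoint B C → ν (B ∪ C) = ν B + ν C)
    {K : ℝ} (hK : 0 ≤ K) (hb : ∀ f : SimpleFunc Ω ℂ,
      ‖∑ c ∈ f.range, c * ν (f ⁻¹' {c})‖ ≤ K * √(∫ ω, ‖f ω‖ ^ 2 ∂P)) :
    ∃ l : Ω → ℂ, MemLp l 2 P ∧ (∀ B, MeasurableSet B → ∫ ω in B, l ω ∂P = ν B) ∧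
      ∫ ω, ‖l ω‖ ^ 2 ∂P ≤ K ^ 2 := by
  let T : Set Ω → ℂ →L[ℝ] ℂ := fun B =>
    ((ContinuousLinearMap.id ℂ ℂ).smulRight (ν B)).restrictScalars ℝ
  have hT : ∀ B c, T B c = c * ν B := fun _ _ => rfl
  have hTadd : FinMeasAdditive P T := fun B C hB hC _ _ hd => by
    ext c
    rw [add_apply, hT, hT, hT, hadd B C hB hC hd, mul_add]
  have hT0 : T ∅ = 0 := by
    have h := hadd ∅ ∅ MeasurableSet.empty MeasurableSet.empty (disjoint_bot_left)
    rw [Set.union_empty, left_eq_add] at h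
    ext c; simp [hT, h]
  have hi : ∀ f : SimpleFunc Ω ℂ, Integrable f P := fun f => f.integrable_of_isFiniteMeasure
  have hm : ∀ f : SimpleFunc Ω ℂ, MemLp f 2 P := fun f => f.memLp_of_isFiniteMeasure 2 P
  let Φ₀ : SimpleFunc Ω ℂ →ₗ[ℂ] ℂ :=
    { toFun := SimpleFunc.setToSimpleFunc T
      map_add' := fun f g => SimpleFunc.setToSimpleFunc_add T hTadd (hi f) (hi g)
      map_smul' := fun c f => SimpleFunc.setToSimpleFunc_smul T hTadd
        (fun c B x => by simp [hT, mul_assoc]) c (hi f) }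
  let e : SimpleFunc Ω ℂ →ₗ[ℂ] Lp ℂ 2 P :=
    { toFun := fun f => (hm f).toLp f
      map_add' := fun f g => MemLp.toLp_add (hm f) (hm g)
      map_smul' := fun c f => MemLp.toLp_const_smul c (hm f) }
  have he : ∀ f, e f = (hm f).toLp f := fun _ => rfl
  have hd : DenseRange e := by
    refine (Lp.simpleFunc.denseRange (μ := P) (E := ℂ) (p := 2) (by simp)).mono ?_
    rintro _ ⟨f, rfl⟩
    refine ⟨Lp.simpleFunc.toSimpleFunc f, ?_⟩
    rw [he]
    exact (Lp.ext ((MemLp.coeFn_toLp _).trans (Lp.simpleFunc.toSimpleFunc_eq_toFun f)))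
  have hn : ∀ f, ‖Φ₀ f‖ ≤ K * ‖e f‖ := fun f => by
    refine (hb f).trans (le_of_eq ?_)
    rw [he, ← norm_toLp_two_sq (hm f), Real.sqrt_sq (norm_nonneg _)]
  -- The bound lets the functional pass to `L²` classes and extend from the dense simple functions.
  let Φ : Lp ℂ 2 P →L[ℂ] ℂ := Φ₀.extendOfNorm e
  have hΦ : ∀ f, Φ (e f) = Φ₀ f := LinearMap.extendOfNorm_eq hd ⟨K, hn⟩
  have hΦn : ‖Φ‖ ≤ K := LinearMap.opNorm_extendOfNorm_le hd hK hn
  let k : Lp ℂ 2 P := (InnerProductSpace.toDual ℂ (Lp ℂ 2 P)).symm Φ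
  have hk : ∀ g, ⟪k, g⟫_ℂ = Φ g := fun g => InnerProductSpace.toDual_symm_apply
  have hkn : ‖k‖ ≤ K := by rwa [LinearIsometryEquiv.norm_map]
  have hkm : MemLp (fun ω => k ω) 2 P := Lp.memLp k
  -- The conjugate appears because the inner product is conjugate linear in the Riesz vector `k`.
  refine ⟨fun ω => starRingEnd ℂ (k ω), hkm.star, fun B hB => ?_, ?_⟩
  · let f : SimpleFunc Ω ℂ := SimpleFunc.piecewise B hB (SimpleFunc.const Ω 1) (SimpleFunc.const Ω 0)
    have h1 : Φ₀ f = ν B := by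
      refine (SimpleFunc.setToSimpleFunc_indicator T hT0 hB (1 : ℂ)).trans ?_
      rw [hT, one_mul]
    rw [← h1, ← hΦ, ← hk, L2.inner_def, ← integral_indicator hB]
    refine integral_congr_ae ?_
    filter_upwards [(hm f).coeFn_toLp] with ω hω
    rw [he, hω]
    by_cases hB' : ω ∈ B
    · simp [f, hB']
    · simp [f, hB']
  · simp only [RCLike.norm_conj]
    rw [← norm_toLp_two_sq hkm, Lp.toLp_coeFn]
    exact pow_le_pow_left₀ (norm_nonneg _) hkn 2

end Density

/-! ### Fisher information of a measurement -/

section Measurement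

variable {H : Type*} [NormedAddCommGroup H] [InnerProductSpace ℂ H] [CompleteSpace H]
  {Ξ : Type*} [NormedAddCommGroup Ξ] [InnerProductSpace ℝ Ξ]
  {Ω : Type*} [MeasurableSpace Ω]

theorem HasTraceFDerivWithinAt.exists_bound {ρ : Ξ → H →L[ℂ] H} {D : Ξ →ₗ[ℝ] (H →L[ℂ] H)}
    {Θ : Set Ξ} {θ : Ξ} (h : HasTraceFDerivWithinAt ρ D Θ θ) :
    ∃ C : ℝ, 0 ≤ C ∧ ∀ φ, IsTraceClass (D φ) ∧ (traceNorm (D φ)).toReal ≤ C * ‖φ‖ := by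
  obtain ⟨C, hC⟩ := h.bounded
  refine ⟨|C|, abs_nonneg C, fun φ => ⟨(hC φ).trans_lt ENNReal.ofReal_lt_top, ?_⟩⟩
  refine ENNReal.toReal_le_of_le_ofReal (by positivity) ((hC φ).trans ?_)
  exact ENNReal.ofReal_le_ofReal (mul_le_mul_of_nonneg_right (le_abs_self C) (norm_nonneg _))

theorem HasTraceFDerivWithinAt.exists_traceCLM {ρ : Ξ → H →L[ℂ] H} {D : Ξ →ₗ[ℝ] (H →L[ℂ] H)}
    {Θ : Set Ξ} {θ : Ξ} (h : HasTraceFDerivWithinAt ρ D Θ θ) (X : H →L[ℂ] H) :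
    ∃ L : Ξ →L[ℝ] ℂ, ∀ φ, L φ = trace (D φ * X) := by
  obtain ⟨C, hC0, hC⟩ := h.exists_bound
  refine ⟨LinearMap.mkContinuous
    { toFun := fun φ => trace (D φ * X)
      map_add' := fun φ χ => ?_
      map_smul' := fun c φ => ?_ } (C * ‖X‖) fun φ => ?_, fun φ => rfl⟩
  · rw [map_add, add_mul, trace_add ((hC φ).1.diagSummable_mul X) ((hC χ).1.diagSummable_mul X)]
  · have : c • D φ * X = (c : ℂ) • (D φ * X) := by
      rw [smul_mul_assoc]; rfl
    rw [map_smul, this, trace_smul]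
    simp
  · refine ((hC φ).1.norm_trace_mul_le X).trans ?_
    rw [mul_right_comm]
    exact mul_le_mul_of_nonneg_right (hC φ).2 (norm_nonneg _)

/-- Pairing with `X` is linear and bounded by `‖X‖` for the trace norm, so it sends the remainder of
`ρ` to an admissible remainder. -/
theorem HasTraceFDerivWithinAt.hasFDerivWithinAt_trace {ρ : Ξ → H →L[ℂ] H}
    {D : Ξ →ₗ[ℝ] (H →L[ℂ] H)} {Θ : Set Ξ} {θ : Ξ} (h : HasTraceFDerivWithinAt ρ D Θ θ)
    (hρ : ∀ ϑ ∈ Θ, IsTraceClass (ρ ϑ)) (hθ : θ ∈ Θ) {X : H →L[ℂ] H} {L : Ξ →L[ℝ] ℂ}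
    (hL : ∀ φ, L φ = trace (D φ * X)) :
    HasFDerivWithinAt (fun ϑ => trace (ρ ϑ * X)) L Θ θ := by
  obtain ⟨C, -, hC⟩ := h.exists_bound
  refine .of_isLittleO (Asymptotics.isLittleO_iff.2 fun c hc => ?_)
  -- The `+ 1` keeps the tolerance positive when `X = 0`.
  filter_upwards [h.isLittleO (c / (‖X‖ + 1)) (by positivity), self_mem_nhdsWithin] with ϑ h1 h2
  have hT : IsTraceClass (ρ ϑ - ρ θ - D (ϑ - θ)) := h1.trans_lt ENNReal.ofReal_lt_top
  have h3 : trace (ρ ϑ * X) - trace (ρ θ * X) - L (ϑ - θ)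
      = trace ((ρ ϑ - ρ θ - D (ϑ - θ)) * X) := by
    have e1 := (hρ ϑ h2).diagSummable_mul X
    have e2 := (hρ θ hθ).diagSummable_mul X
    have e3 : DiagSummable (ρ ϑ * X - ρ θ * X) := by
      refine (Summable.sub e1 e2).congr fun i => ?_
      rw [sub_apply, inner_sub_right]
    rw [hL, sub_mul, sub_mul, trace_sub e3 ((hC _).1.diagSummable_mul X), trace_sub e1 e2]
  rw [h3]
  refine (hT.norm_trace_mul_le X).trans ?_
  have h4 := ENNReal.toReal_le_of_le_ofReal (by positivity) h1
  refine (mul_le_mul_of_nonneg_right h4 (norm_nonneg X)).trans ?_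
  rw [mul_right_comm]
  refine mul_le_mul_of_nonneg_right ?_ (norm_nonneg _)
  rw [div_mul_eq_mul_div, div_le_iff₀ (by positivity)]
  nlinarith [norm_nonneg X]

namespace Model

variable {S : Model H Ξ} {θ : Ξ} {M : POVM Ω H} {P : Ξ → Measure Ω}

theorem isOutcomeLaw_law (S : Model H Ξ) (M : POVM Ω H) :
    S.IsOutcomeLaw M fun ϑ => M.law (S.ρ ϑ) := fun ϑ hϑ =>
  ⟨M.isProbabilityMeasure_law (S.isDensity ϑ hϑ), fun _ hB => M.law_real (S.isDensity ϑ hϑ) hB⟩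

theorem IsOutcomeLaw.eq {P' : Ξ → Measure Ω} (hP : S.IsOutcomeLaw M P)
    (hP' : S.IsOutcomeLaw M P') (hθ : θ ∈ S.Θ) : P θ = P' θ := by
  have := (hP θ hθ).1
  have := (hP' θ hθ).1
  refine Measure.ext fun B hB => ?_
  have h := ((hP θ hθ).2 B hB).trans ((hP' θ hθ).2 B hB).symm
  exact (measureReal_eq_measureReal_iff).1 (Complex.ofReal_inj.1 h)

theorem IsOutcomeLaw.hasFDerivWithinAt (hP : S.IsOutcomeLaw M P) (hθ : θ ∈ S.Θ) {B : Set Ω}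
    (hB : MeasurableSet B) :
    DifferentiableWithinAt ℝ (fun ϑ => (P ϑ).real B) S.Θ θ ∧
      ∀ φ, (fderivWithin ℝ (fun ϑ => (P ϑ).real B) S.Θ θ φ : ℂ)
        = trace (S.D θ φ * M.toFun B) := by
  obtain ⟨L, hL⟩ := (S.hasDeriv θ hθ).exists_traceCLM (M.toFun B)
  have h1 : HasFDerivWithinAt (fun ϑ => ((P ϑ).real B : ℂ)) L S.Θ θ :=
    ((S.hasDeriv θ hθ).hasFDerivWithinAt_trace (fun ϑ hϑ => (S.isDensity ϑ hϑ).isTraceClass) hθ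
      hL).congr (fun ϑ hϑ => (hP ϑ hϑ).2 B hB) ((hP θ hθ).2 B hB)
  have h2 : HasFDerivWithinAt (fun ϑ => (P ϑ).real B) (Complex.reCLM ∘L L) S.Θ θ := by
    have := Complex.reCLM.hasFDerivAt.comp_hasFDerivWithinAt θ h1
    simpa [Function.comp_def] using this
  have h3 : HasFDerivWithinAt (fun ϑ => ((P ϑ).real B : ℂ))
      (Complex.ofRealCLM ∘L Complex.reCLM ∘L L) S.Θ θ :=
    Complex.ofRealCLM.hasFDerivAt.comp_hasFDerivWithinAt θ h2
  -- The probabilities are real, so `L` and its real part are both derivatives of the same function;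
  -- uniqueness of derivatives relative to `Θ` makes `L` real valued.
  have h4 := (S.uniqueDiff θ hθ).eq h1 h3
  refine ⟨h2.differentiableWithinAt, fun φ => ?_⟩
  rw [h2.fderivWithin (S.uniqueDiff θ hθ), ← hL]
  exact (congrArg (fun T : Ξ →L[ℝ] ℂ => T φ) h4).symm

end Model

/-- The functional `f ↦ Tr[d M(f)]` is bounded by `K` for the norm of `L²(P)`. -/
def POVM.BoundedBy (M : POVM Ω H) (P : Measure Ω) (d : H →L[ℂ] H) (K : ℝ) : Prop :=
  ∀ f : SimpleFunc Ω ℂ, ‖trace (d * M.simpleInt f id)‖ ≤ K * √(∫ ω, ‖f ω‖ ^ 2 ∂P)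

/-- Cyclicity turns the trace into `Tr[Y · M(f) √r]`, to which Cauchy–Schwarz and the Kadison
estimate apply. -/
theorem POVM.boundedBy_of_sqrt_mul {M : POVM Ω H} {P : Measure Ω} [IsFiniteMeasure P]
    {r : H →L[ℂ] H} (hr : IsDensity r)
    (hP : ∀ B, MeasurableSet B → (P.real B : ℂ) = trace (r * M.toFun B))
    {Y : H →L[ℂ] H} (hY : IsHilbertSchmidt Y) : M.BoundedBy P (CFC.sqrt r * Y) (hsNorm Y) := by
  intro f
  have hs := hr.isHilbertSchmidt_sqrt
  rw [mul_assoc, trace_mul_comm hs (hY.mul_right _), mul_assoc]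
  refine (norm_trace_mul_le hY (hs.mul_left _)).trans ?_
  refine mul_le_mul_of_nonneg_left ?_ (hsNorm_nonneg _)
  exact Real.le_sqrt_of_sq_le (M.hsNorm_simpleInt_mul_sqrt_le hr hP f fun _ => rfl)

/-- Here `√r` stands to the left of `M(f)`. Passing to the adjoint replaces `√r M(f)` by the
operator of the conjugate function times `√r`, of equal Hilbert–Schmidt norm. -/
theorem POVM.boundedBy_of_mul_sqrt {M : POVM Ω H} {P : Measure Ω} [IsFiniteMeasure P]
    {r : H →L[ℂ] H} (hr : IsDensity r)
    (hP : ∀ B, MeasurableSet B → (P.real B : ℂ) = trace (r * M.toFun B))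
    {A : H →L[ℂ] H} (hA : IsHilbertSchmidt A) : M.BoundedBy P (A * CFC.sqrt r) (hsNorm A) := by
  intro f
  have hs := hr.isHilbertSchmidt_sqrt
  have hss : star (CFC.sqrt r) = CFC.sqrt r := (CFC.sqrt_nonneg r).isSelfAdjoint.star_eq
  rw [mul_assoc]
  refine (norm_trace_mul_le hA (hs.mul_right _)).trans ?_
  refine mul_le_mul_of_nonneg_left ?_ (hsNorm_nonneg _)
  rw [← hsNorm_star (hs.mul_right _), star_mul, hss, M.star_simpleInt]
  exact Real.le_sqrt_of_sq_le (M.hsNorm_simpleInt_mul_sqrt_le hr hP f fun c => RCLike.norm_conj c)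

theorem IsRLD.boundedBy {M : POVM Ω H} {P : Measure Ω} [IsFiniteMeasure P]
    {r d Y : H →L[ℂ] H} (hr : IsDensity r)
    (hP : ∀ B, MeasurableSet B → (P.real B : ℂ) = trace (r * M.toFun B))
    (hY : IsRLD r d Y) : M.BoundedBy P d (hsNorm Y) := by
  rw [← hY.eqn]
  exact POVM.boundedBy_of_sqrt_mul hr hP hY.isHilbertSchmidt

/-- `d` is the mean of `√r A*` and `A √r`, and each of them satisfies the bound with the norm of
`A`. -/
theorem IsSLD.boundedBy {M : POVM Ω H} {P : Measure Ω} [IsFiniteMeasure P]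
    {r d A : H →L[ℂ] H} (hr : IsDensity r)
    (hP : ∀ B, MeasurableSet B → (P.real B : ℂ) = trace (r * M.toFun B))
    (hA : IsSLD r d A) : M.BoundedBy P d (hsNorm A) := by
  intro f
  have hs := hr.isHilbertSchmidt_sqrt
  have hA' := hA.isHilbertSchmidt
  have h1 := POVM.boundedBy_of_sqrt_mul hr hP hA'.star f
  have h2 := POVM.boundedBy_of_mul_sqrt hr hP hA' f
  rw [hsNorm_star hA'] at h1
  rw [← hA.eqn, smul_mul_assoc, trace_smul, add_mul, trace_add, norm_mul]
  · have h3 := norm_add_le (trace (CFC.sqrt r * star A * M.simpleInt f id))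
      (trace (A * CFC.sqrt r * M.simpleInt f id))
    have h4 : ‖(2⁻¹ : ℂ)‖ = 2⁻¹ := by simp
    rw [h4]
    linarith
  · rw [mul_assoc]; exact hs.diagSummable_mul (hA'.star.mul_right _)
  · rw [mul_assoc]; exact hA'.diagSummable_mul (hs.mul_right _)

/-- The set function `B ↦ Tr[d M(B)]` has a square integrable density as soon as the functional
`f ↦ Tr[d M(f)]` is bounded. -/
theorem POVM.BoundedBy.exists_density {M : POVM Ω H} {P : Measure Ω} [IsFiniteMeasure P]
    {d : H →L[ℂ] H} (hd : ∀ X, DiagSummable (d * X)) {K : ℝ} (hK : 0 ≤ K)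
    (h : M.BoundedBy P d K) :
    ∃ l : Ω → ℂ, MemLp l 2 P ∧ (∀ B, MeasurableSet B → ∫ ω in B, l ω ∂P = trace (d * M.toFun B)) ∧
      ∫ ω, ‖l ω‖ ^ 2 ∂P ≤ K ^ 2 := by
  refine exists_density_of_bound (ν := fun B => trace (d * M.toFun B)) (fun B C hB hC hBC => ?_) hK
    fun f => ?_
  · simp only [M.map_union hB hC hBC, mul_add]
    exact trace_add (hd _) (hd _)
  · refine le_of_eq_of_le (congrArg norm ?_) (h f)
    rw [POVM.simpleInt]
    induction f.range using Finset.cons_induction with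
    | empty => simp [trace]
    | cons a s ha ih =>
      rw [Finset.sum_cons, Finset.sum_cons, mul_add, trace_add (hd _) (hd _), ih, mul_smul_comm,
        trace_smul]
      rfl

/-- Densities are unique almost everywhere, so the bound on the Riesz density holds for every one of
them, without assuming square integrability beforehand. -/
theorem POVM.BoundedBy.integral_norm_sq_le {M : POVM Ω H} {P : Measure Ω} [IsFiniteMeasure P]
    {d : H →L[ℂ] H} (hd : ∀ X, DiagSummable (d * X)) {K : ℝ} (hK : 0 ≤ K)
    (h : M.BoundedBy P d K) {l : Ω → ℂ} (hl : Integrable l P)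
    (hlB : ∀ B, MeasurableSet B → ∫ ω in B, l ω ∂P = trace (d * M.toFun B)) :
    ∫ ω, ‖l ω‖ ^ 2 ∂P ≤ K ^ 2 := by
  obtain ⟨l', hl', hl'B, hb⟩ := h.exists_density hd hK
  have hae : l =ᵐ[P] l' :=
    hl.ae_eq_of_forall_setIntegral_eq _ _ (hl'.integrable (by norm_num)) fun B hB _ =>
      (hlB B hB).trans (hl'B B hB).symm
  refine le_of_eq_of_le (integral_congr_ae ?_) hb
  filter_upwards [hae] with ω hω
  rw [hω]

/-- The operator `T* T` of a bounded operator `T`, through its form. -/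
theorem exists_gram {𝕜 E F : Type*} [RCLike 𝕜] [NormedAddCommGroup E] [InnerProductSpace 𝕜 E]
    [CompleteSpace E] [NormedAddCommGroup F] [InnerProductSpace 𝕜 F] [CompleteSpace F]
    (T : E →L[𝕜] F) : ∃ J : E →L[𝕜] E, ∀ φ χ, inner 𝕜 φ (J χ) = inner 𝕜 (T φ) (T χ) :=
  ⟨ContinuousLinearMap.adjoint T ∘L T, fun φ χ => by
    rw [ContinuousLinearMap.comp_apply, ContinuousLinearMap.adjoint_inner_right]⟩

namespace Model

variable {S : Model H Ξ} {θ : Ξ} {M : POVM Ω H} {P : Ξ → Measure Ω}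

theorem diagSummable_D (S : Model H Ξ) (hθ : θ ∈ S.Θ) (φ : Ξ) (X : H →L[ℂ] H) :
    DiagSummable (S.D θ φ * X) := by
  obtain ⟨C, -, hC⟩ := (S.hasDeriv θ hθ).exists_bound
  exact (hC φ).1.diagSummable_mul X

/-- The right-hand side involves the law at `θ` only. Logarithmic derivatives can therefore be
transferred between two families of outcome laws, which need not agree outside `Θ`. -/
theorem IsOutcomeLaw.isLogDeriv_iff (hP : S.IsOutcomeLaw M P) (hθ : θ ∈ S.Θ) {φ : Ξ}
    {l : Ω → ℝ} : IsLogDeriv P S.Θ θ φ l ↔ Integrable l (P θ) ∧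
      ∀ B, MeasurableSet B → ∫ ω in B, (l ω : ℂ) ∂(P θ) = trace (S.D θ φ * M.toFun B) := by
  constructor
  · rintro ⟨h1, h2⟩
    refine ⟨h1, fun B hB => ?_⟩
    rw [integral_complex_ofReal, ← h2 B hB, (hP.hasFDerivWithinAt hθ hB).2]
  · rintro ⟨h1, h2⟩
    refine ⟨h1, fun B hB => ?_⟩
    have h3 := h2 B hB
    rw [integral_complex_ofReal, ← (hP.hasFDerivWithinAt hθ hB).2] at h3
    exact (Complex.ofReal_inj.1 h3).symm

theorem IsOutcomeLaw.exists_isLogDeriv (hP : S.IsOutcomeLaw M P) (hθ : θ ∈ S.Θ) {φ : Ξ} {K : ℝ}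
    (hK : 0 ≤ K) (h : M.BoundedBy (P θ) (S.D θ φ) K) :
    ∃ l, IsLogDeriv P S.Θ θ φ l ∧ MemLp l 2 (P θ) := by
  have := (hP θ hθ).1
  obtain ⟨l, h1, h2, -⟩ := h.exists_density (S.diagSummable_D hθ φ) hK
  refine ⟨fun ω => (l ω).re, ⟨(h1.integrable (by norm_num)).re, fun B hB => ?_⟩, h1.re⟩
  have h3 := (hP.hasFDerivWithinAt hθ hB).2 φ
  rw [← h2 B hB] at h3
  have h4 := congrArg Complex.re h3
  rw [Complex.ofReal_re] at h4
  rw [h4]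
  exact (integral_re (h1.integrable (by norm_num)).integrableOn).symm

theorem IsOutcomeLaw.integral_sq_le (hP : S.IsOutcomeLaw M P) (hθ : θ ∈ S.Θ) {φ : Ξ} {K : ℝ}
    (hK : 0 ≤ K) (h : M.BoundedBy (P θ) (S.D θ φ) K) {l : Ω → ℝ} (hl : IsLogDeriv P S.Θ θ φ l) :
    ∫ ω, l ω ^ 2 ∂(P θ) ≤ K ^ 2 := by
  have := (hP θ hθ).1
  have h1 := (hP.isLogDeriv_iff hθ).1 hl
  have h2 := h.integral_norm_sq_le (S.diagSummable_D hθ φ) hK h1.1.ofReal h1.2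
  simpa using h2

/-- Existence and uniqueness of the Fisher information operator of a measurement. -/
theorem existsUnique_isMeasFisher [CompleteSpace Ξ] (S : Model H Ξ) (hθ : θ ∈ S.Θ) (M : POVM Ω H)
    {K : Ξ → ℝ} (hK : ∀ φ, 0 ≤ K φ) {C : ℝ} (hC : ∀ φ, K φ ≤ C * ‖φ‖)
    (h : ∀ P : Ξ → Measure Ω, S.IsOutcomeLaw M P → ∀ φ, M.BoundedBy (P θ) (S.D θ φ) (K φ)) :
    ∃! J, S.IsMeasFisher θ M J := by
  have hP := S.isOutcomeLaw_law M
  set P : Ξ → Measure Ω := fun ϑ => M.law (S.ρ ϑ) with hPdef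
  have := (hP θ hθ).1
  choose l hl hl2 using fun φ => hP.exists_isLogDeriv hθ (hK φ) (h P hP φ)
  have hadd : ∀ φ χ, l (φ + χ) =ᵐ[P θ] l φ + l χ := fun φ χ => by
    refine (hl (φ + χ)).ae_eq ⟨(hl φ).integrable.add (hl χ).integrable, fun B hB => ?_⟩
    rw [map_add, (hl φ).eqn B hB, (hl χ).eqn B hB]
    exact (integral_add (hl φ).integrable.integrableOn (hl χ).integrable.integrableOn).symm
  have hsmul : ∀ (c : ℝ) φ, l (c • φ) =ᵐ[P θ] c • l φ := fun c φ => by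
    refine (hl (c • φ)).ae_eq ⟨(hl φ).integrable.smul c, fun B hB => ?_⟩
    rw [map_smul, (hl φ).eqn B hB]
    exact (integral_smul c _).symm
  have hin : ∀ φ χ, ⟪(hl2 φ).toLp (l φ), (hl2 χ).toLp (l χ)⟫_ℝ
      = ∫ ω, l φ ω * l χ ω ∂(P θ) := fun φ χ => by
    rw [L2.inner_def]
    refine integral_congr_ae ?_
    filter_upwards [(hl2 φ).coeFn_toLp, (hl2 χ).coeFn_toLp] with ω h1 h2
    rw [h1, h2]
    simp [mul_comm]
  -- Almost everywhere uniqueness makes `φ ↦ l φ` linear into `L²`, and the second moment bound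
  -- makes it continuous; the information operator is its Gram operator.
  let T₀ : Ξ →ₗ[ℝ] Lp ℝ 2 (P θ) :=
    { toFun := fun φ => (hl2 φ).toLp (l φ)
      map_add' := fun φ χ => by
        rw [← MemLp.toLp_add]
        exact MemLp.toLp_congr _ _ (hadd φ χ)
      map_smul' := fun c φ => by
        rw [RingHom.id_apply, ← MemLp.toLp_const_smul]
        exact MemLp.toLp_congr _ _ (hsmul c φ) }
  let T : Ξ →L[ℝ] Lp ℝ 2 (P θ) := T₀.mkContinuous C fun φ => by
    refine le_trans ?_ (hC φ)
    refine le_of_sq_le_sq ?_ (hK φ)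
    rw [← real_inner_self_eq_norm_sq]
    refine le_of_eq_of_le (hin φ φ) ?_
    simp only [← sq]
    exact hP.integral_sq_le hθ (hK φ) (h P hP φ) (hl φ)
  obtain ⟨J, hJ⟩ := exists_gram T
  refine ⟨J, ⟨P, hP, fun B hB => (hP.hasFDerivWithinAt hθ hB).1, l, hl, hl2, fun φ χ => ?_⟩, ?_⟩
  · rw [hJ]
    exact hin φ χ
  · rintro J' ⟨P', hP', -, l', h1, -, h3⟩
    ext χ
    refine ext_inner_left ℝ fun φ => ?_
    have hae : ∀ φ, l' φ =ᵐ[P θ] l φ := fun φ => by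
      refine IsLogDeriv.ae_eq ((hP.isLogDeriv_iff hθ).2 ?_) (hl φ)
      have := (hP'.isLogDeriv_iff hθ).1 (h1 φ)
      rwa [hP'.eq hP hθ] at this
    rw [h3, hJ, hP'.eq hP hθ]
    refine Eq.trans (integral_congr_ae ?_) (hin φ χ).symm
    filter_upwards [hae φ, hae χ] with ω e1 e2
    rw [e1, e2]

end Model

end Measurement

/-! ### Symmetric and right logarithmic derivatives -/

section LogarithmicDerivative

variable {H : Type*} [NormedAddCommGroup H] [InnerProductSpace ℂ H] [CompleteSpace H]
  {Ξ : Type*} [NormedAddCommGroup Ξ] [InnerProductSpace ℝ Ξ]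
  {r d d' A A' : H →L[ℂ] H}

theorem star_sqrt (r : H →L[ℂ] H) : star (CFC.sqrt r) = CFC.sqrt r :=
  (CFC.sqrt_nonneg r).isSelfAdjoint.star_eq

theorem IsDensity.nonneg (hr : IsDensity r) : 0 ≤ r :=
  (ContinuousLinearMap.nonneg_iff_isPositive r).2 hr.isPositive

theorem eq_zero_of_sqrt_mul_eq_zero (hr : IsDensity r) (hr0 : IsStrictlyPos r)
    (h : CFC.sqrt r * A = 0) : A = 0 := by
  ext x
  by_contra hx
  have h1 := hr0 (A x) hx
  rw [← norm_sqrt_apply_sq hr.nonneg, ← mul_apply_eq_comp, h] at h1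
  simp at h1

theorem IsSLD.add (h : IsSLD r d A) (h' : IsSLD r d' A') : IsSLD r (d + d') (A + A') where
  isHilbertSchmidt := h.isHilbertSchmidt.add h'.isHilbertSchmidt
  isSelfAdjoint := by rw [mul_add]; exact h.isSelfAdjoint.add h'.isSelfAdjoint
  eqn := by rw [← h.eqn, ← h'.eqn, star_add, mul_add, add_mul, ← smul_add]; congr 1; abel

theorem IsSLD.smul (c : ℝ) (h : IsSLD r d A) : IsSLD r (c • d) (c • A) where
  isHilbertSchmidt := h.isHilbertSchmidt.const_smul_real c
  isSelfAdjoint := by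
    rw [mul_smul_comm]
    exact (IsSelfAdjoint.all c).smul h.isSelfAdjoint
  eqn := by
    rw [← h.eqn, star_smul, star_trivial, mul_smul_comm, smul_mul_assoc, ← smul_add, smul_comm]

/-- The difference `E` satisfies `E* s = s E` and `s E* = -E s`, whence `r E = -E r`. Then `E`
commutes with `r²`, hence with its square root `r`, so `r E = 0`; and `r` is injective. -/
theorem IsSLD.unique (hr : IsDensity r) (hr0 : IsStrictlyPos r) (h : IsSLD r d A)
    (h' : IsSLD r d A') : A = A' := by
  have h0 := h.add (h'.smul (-1))
  rw [← sub_eq_zero]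
  have e1 : d + (-1 : ℝ) • d = 0 := by simp
  have e2 : A + (-1 : ℝ) • A' = A - A' := by simp [sub_eq_add_neg]
  rw [e1, e2] at h0
  set E := A - A'
  set s := CFC.sqrt r with hs
  have h1 : star E * s = s * E := by
    have := h0.isSelfAdjoint.star_eq
    rwa [star_mul, star_sqrt] at this
  have h2 : s * star E = -(E * s) := by
    have := (smul_eq_zero.1 h0.eqn).resolve_left (by norm_num)
    exact eq_neg_of_add_eq_zero_left this
  have hss : s * s = r := hr.sqrt_mul_sqrt
  have h3 : r * E = -(E * r) := by
    rw [← hss, mul_assoc, ← h1, ← mul_assoc, h2, neg_mul, mul_assoc]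
  have h4 : Commute (r * r) E := by
    rw [Commute, SemiconjBy, mul_assoc, h3, mul_neg, ← mul_assoc, h3, neg_mul, neg_neg, mul_assoc]
  have h5 : Commute r E := by
    have := h4.cfcₙ_nnreal NNReal.sqrt
    rwa [← CFC.sqrt, CFC.sqrt_mul_self r hr.nonneg] at this
  have h6 : r * E = 0 := by
    have h7 : r * E + r * E = 0 := by
      nth_rewrite 1 [h3]
      rw [h5.eq, neg_add_cancel]
    rw [← two_smul ℂ] at h7
    exact (smul_eq_zero.1 h7).resolve_left two_ne_zero
  rw [← hss, mul_assoc] at h6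
  exact eq_zero_of_sqrt_mul_eq_zero hr hr0 (eq_zero_of_sqrt_mul_eq_zero hr hr0 h6)

theorem IsRLD.add (h : IsRLD r d A) (h' : IsRLD r d' A') : IsRLD r (d + d') (A + A') where
  isHilbertSchmidt := h.isHilbertSchmidt.add h'.isHilbertSchmidt
  eqn := by rw [mul_add, h.eqn, h'.eqn]

theorem IsRLD.smul (c : ℂ) (h : IsRLD r d A) : IsRLD r (c • d) (c • A) where
  isHilbertSchmidt := h.isHilbertSchmidt.const_smul c
  eqn := by rw [mul_smul_comm, h.eqn]

theorem IsRLD.unique (hr : IsDensity r) (hr0 : IsStrictlyPos r) (h : IsRLD r d A)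
    (h' : IsRLD r d A') : A = A' := by
  rw [← sub_eq_zero]
  refine eq_zero_of_sqrt_mul_eq_zero hr hr0 ?_
  rw [mul_sub, h.eqn, h'.eqn, sub_self]

/-- A linear map into the Hilbert–Schmidt operators whose graph is closed for the operator norm is
bounded for the Hilbert–Schmidt norm. -/
theorem exists_hsCLM [CompleteSpace Ξ] (A : Ξ →ₗ[ℝ] (H →L[ℂ] H))
    (hA : ∀ φ, IsHilbertSchmidt (A φ))
    (hcl : ∀ (u : ℕ → Ξ) (φ : Ξ) (B : H →L[ℂ] H), IsHilbertSchmidt B → Tendsto u atTop (𝓝 φ) →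
      Tendsto (fun n => A (u n)) atTop (𝓝 B) → B = A φ) :
    ∃ T : Ξ →L[ℝ] HSSpace H, ∀ φ, T φ = (hA φ).vec := by
  let T₀ : Ξ →ₗ[ℝ] HSSpace H :=
    { toFun := fun φ => (hA φ).vec
      map_add' := fun φ χ => Subtype.ext (funext fun i => by
        change A (φ + χ) (stdBasis H i) = A φ (stdBasis H i) + A χ (stdBasis H i)
        rw [map_add]; rfl)
      map_smul' := fun c φ => Subtype.ext (funext fun i => by
        change A (c • φ) (stdBasis H i) = (c : ℂ) • A φ (stdBasis H i)
        rw [map_smul]; rfl) }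
  have hT₀ : ∀ φ, T₀ φ = (hA φ).vec := fun _ => rfl
  have hle : ∀ φ, ‖A φ‖ ≤ ‖T₀ φ‖ := fun φ => by
    rw [hT₀, (hA φ).norm_vec]; exact (hA φ).norm_le
  have hcont : Continuous T₀ := by
    -- Closed graph theorem. The Hilbert–Schmidt norm dominates the operator norm, so a
    -- Hilbert–Schmidt limit `y` is also an operator limit `B`, with columns `B eᵢ = yᵢ`; the
    -- hypothesis `hcl` then identifies `B`.
    refine T₀.continuous_of_seq_closed_graph fun u φ y hu hy => ?_
    have hc : CauchySeq fun n => A (u n) := by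
      refine Metric.cauchySeq_iff.2 fun ε hε => ?_
      obtain ⟨N, hN⟩ := Metric.cauchySeq_iff.1 hy.cauchySeq ε hε
      refine ⟨N, fun m hm n hn => lt_of_le_of_lt ?_ (hN m hm n hn)⟩
      rw [dist_eq_norm, dist_eq_norm, ← map_sub]
      refine (hle _).trans (le_of_eq ?_)
      rw [map_sub]; rfl
    obtain ⟨B, hB⟩ := cauchySeq_tendsto_of_complete hc
    have hBi : ∀ i, B (stdBasis H i) = y.1 i := fun i => by
      have h1 : Tendsto (fun n => A (u n) (stdBasis H i)) atTop (𝓝 (B (stdBasis H i))) :=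
        ((ContinuousLinearMap.apply ℂ H (stdBasis H i)).continuous.tendsto B).comp hB
      refine tendsto_nhds_unique h1 ?_
      rw [tendsto_iff_norm_sub_tendsto_zero] at hy ⊢
      refine squeeze_zero (fun _ => norm_nonneg _) (fun n => ?_) hy
      exact lp.norm_apply_le_norm (E := fun _ : basisIndex H => H) (p := 2) two_ne_zero
        (T₀ (u n) - y) i
    have hBHS : IsHilbertSchmidt B := by
      unfold IsHilbertSchmidt
      simp only [hBi]
      simpa using (lp.memℓp (E := fun _ : basisIndex H => H) (p := 2) y).summable (by simp)
    have hBA := hcl u φ B hBHS hu hB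
    refine Subtype.ext (funext fun i => ?_)
    rw [← hBi, hBA]
    rfl
  exact ⟨⟨T₀, hcont⟩, fun φ => rfl⟩

theorem HasTraceFDerivWithinAt.continuous {ρ : Ξ → H →L[ℂ] H} {D : Ξ →ₗ[ℝ] (H →L[ℂ] H)}
    {Θ : Set Ξ} {θ : Ξ} (h : HasTraceFDerivWithinAt ρ D Θ θ) : Continuous D := by
  obtain ⟨C, -, hC⟩ := h.exists_bound
  exact AddMonoidHomClass.continuous_of_bound D C fun φ => ((hC φ).1.norm_le).trans (hC φ).2

/-- Comparison of operators through their forms. -/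
theorem le_of_inner_le {𝕜 E : Type*} [RCLike 𝕜] [NormedAddCommGroup E] [InnerProductSpace 𝕜 E]
    {J J' : E →L[𝕜] E} (hJ : ∀ φ χ, starRingEnd 𝕜 (inner 𝕜 φ (J χ)) = inner 𝕜 χ (J φ))
    (hJ' : ∀ φ χ, starRingEnd 𝕜 (inner 𝕜 φ (J' χ)) = inner 𝕜 χ (J' φ))
    (h : ∀ φ, RCLike.re (inner 𝕜 φ (J φ)) ≤ RCLike.re (inner 𝕜 φ (J' φ))) : J ≤ J' := by
  rw [ContinuousLinearMap.le_def, ContinuousLinearMap.isPositive_def]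
  refine ⟨fun φ χ => ?_, fun φ => ?_⟩
  · have e1 := hJ χ φ
    have e2 := hJ' χ φ
    rw [inner_conj_symm] at e1 e2
    simp only [ContinuousLinearMap.coe_coe, sub_apply, inner_sub_left, inner_sub_right, e1, e2]
  · rw [ContinuousLinearMap.reApplyInnerSelf_apply, sub_apply, ← inner_conj_symm, RCLike.conj_re,
      inner_sub_right, map_sub, sub_nonneg]
    exact h φ

namespace Model

variable {S : Model H Ξ} {θ : Ξ}

/-- The symmetric logarithmic derivative depends linearly and continuously on the direction. -/
theorem HasSLD.exists_clm [CompleteSpace Ξ] (hθ : θ ∈ S.Θ) (h : S.HasSLD θ) :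
    ∃ (A : Ξ → H →L[ℂ] H) (hA : ∀ φ, IsSLD (S.ρ θ) (S.D θ φ) (A φ)) (T : Ξ →L[ℝ] HSSpace H),
      ∀ φ, T φ = (hA φ).isHilbertSchmidt.vec := by
  choose A hA using h
  have hr := S.isDensity θ hθ
  have hr0 := S.isStrictlyPos θ hθ
  -- Arbitrarily chosen solutions depend linearly on `φ` because the solution is unique. The same
  -- uniqueness closes the graph below: the defining equations survive operator norm limits.
  let A' : Ξ →ₗ[ℝ] (H →L[ℂ] H) :=
    { toFun := A
      map_add' := fun φ χ => (hA _).unique hr hr0 (by rw [map_add]; exact (hA φ).add (hA χ))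
      map_smul' := fun c φ => (hA _).unique hr hr0 (by rw [map_smul]; exact (hA φ).smul c) }
  obtain ⟨T, hT⟩ := exists_hsCLM A' (fun φ => (hA φ).isHilbertSchmidt) fun u φ B hB hu hAB => by
    have hD : Tendsto (fun n => S.D θ (u n)) atTop (𝓝 (S.D θ φ)) :=
      ((S.hasDeriv θ hθ).continuous.tendsto φ).comp hu
    have hstar : Tendsto (fun n => star (A (u n))) atTop (𝓝 (star B)) :=
      (continuous_star.tendsto B).comp hAB
    refine IsSLD.unique hr hr0 (d := S.D θ φ) ⟨hB, ?_, ?_⟩ (hA φ)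
    · have h1 : Tendsto (fun n => CFC.sqrt (S.ρ θ) * A (u n)) atTop (𝓝 (CFC.sqrt (S.ρ θ) * B)) :=
        tendsto_const_nhds.mul hAB
      refine tendsto_nhds_unique ((continuous_star.tendsto _).comp h1) (h1.congr fun n => ?_)
      exact (hA (u n)).isSelfAdjoint.star_eq.symm
    · refine tendsto_nhds_unique ?_ hD
      refine Tendsto.congr (fun n => (hA (u n)).eqn) ?_
      exact ((tendsto_const_nhds.mul hstar).add (hAB.mul tendsto_const_nhds)).const_smul _
  exact ⟨A, hA, T, hT⟩

/-- The right logarithmic derivative depends linearly and continuously on the direction. -/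
theorem HasRLD.exists_clm [CompleteSpace Ξ] (hθ : θ ∈ S.Θ) (h : S.HasRLD θ) :
    ∃ (Y : Ξ → H →L[ℂ] H) (hY : ∀ φ, IsRLD (S.ρ θ) (S.D θ φ) (Y φ)) (T : Ξ →L[ℝ] HSSpace H),
      ∀ φ, T φ = (hY φ).isHilbertSchmidt.vec := by
  choose Y hY using h
  have hr := S.isDensity θ hθ
  have hr0 := S.isStrictlyPos θ hθ
  let Y' : Ξ →ₗ[ℝ] (H →L[ℂ] H) :=
    { toFun := Y
      map_add' := fun φ χ => (hY _).unique hr hr0 (by rw [map_add]; exact (hY φ).add (hY χ))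
      map_smul' := fun c φ => (hY _).unique hr hr0 (by
        rw [map_smul]; exact (hY φ).smul (c : ℂ)) }
  obtain ⟨T, hT⟩ := exists_hsCLM Y' (fun φ => (hY φ).isHilbertSchmidt) fun u φ B hB hu hYB => by
    have hD : Tendsto (fun n => S.D θ (u n)) atTop (𝓝 (S.D θ φ)) :=
      ((S.hasDeriv θ hθ).continuous.tendsto φ).comp hu
    refine IsRLD.unique hr hr0 (d := S.D θ φ) ⟨hB, ?_⟩ (hY φ)
    refine tendsto_nhds_unique ?_ hD
    exact Tendsto.congr (fun n => (hY (u n)).eqn) (tendsto_const_nhds.mul hYB)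
  exact ⟨Y, hY, T, hT⟩

theorem HasSLD.existsUnique_isSLDFisher [CompleteSpace Ξ] (hθ : θ ∈ S.Θ) (h : S.HasSLD θ) :
    ∃! J, S.IsSLDFisher θ J := by
  obtain ⟨A, hA, T, hT⟩ := h.exists_clm hθ
  -- Over the reals the inner product is the real part, which is exactly the form defining the
  -- symmetric information.
  let _ : InnerProductSpace ℝ (HSSpace H) := InnerProductSpace.complexToReal
  obtain ⟨J, hJ⟩ := exists_gram (𝕜 := ℝ) (E := Ξ) (F := HSSpace H) T
  have hJ' : ∀ φ χ, ⟪φ, J χ⟫_ℝ = (hsInner (A φ) (A χ)).re := fun φ χ => by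
    rw [hJ, hT, hT]; rfl
  refine ⟨J, ⟨A, hA, hJ'⟩, ?_⟩
  rintro J' ⟨A', hA', h'⟩
  ext χ
  refine ext_inner_left ℝ fun φ => ?_
  have e : ∀ φ, A' φ = A φ := fun φ =>
    (hA' φ).unique (S.isDensity θ hθ) (S.isStrictlyPos θ hθ) (hA φ)
  rw [h', hJ', e, e]

theorem HasSLD.existsUnique_isMeasFisher [CompleteSpace Ξ] (hθ : θ ∈ S.Θ) (h : S.HasSLD θ)
    {Ω : Type*} [MeasurableSpace Ω] (M : POVM Ω H) : ∃! J, S.IsMeasFisher θ M J := by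
  obtain ⟨A, hA, T, hT⟩ := h.exists_clm hθ
  refine S.existsUnique_isMeasFisher hθ M (K := fun φ => hsNorm (A φ)) (C := ‖T‖)
    (fun φ => hsNorm_nonneg _) (fun φ => ?_) fun P hP φ => ?_
  · rw [← (hA φ).isHilbertSchmidt.norm_vec, ← hT]
    exact T.le_opNorm φ
  · have := (hP θ hθ).1
    exact (hA φ).boundedBy (S.isDensity θ hθ) (hP θ hθ).2

theorem HasRLD.existsUnique_isMeasFisher [CompleteSpace Ξ] (hθ : θ ∈ S.Θ) (h : S.HasRLD θ)
    {Ω : Type*} [MeasurableSpace Ω] (M : POVM Ω H) : ∃! J, S.IsMeasFisher θ M J := by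
  obtain ⟨Y, hY, T, hT⟩ := h.exists_clm hθ
  refine S.existsUnique_isMeasFisher hθ M (K := fun φ => hsNorm (Y φ)) (C := ‖T‖)
    (fun φ => hsNorm_nonneg _) (fun φ => ?_) fun P hP φ => ?_
  · rw [← (hY φ).isHilbertSchmidt.norm_vec, ← hT]
    exact T.le_opNorm φ
  · have := (hP θ hθ).1
    exact (hY φ).boundedBy (S.isDensity θ hθ) (hP θ hθ).2

theorem IsMeasFisher.symm {Ω : Type*} [MeasurableSpace Ω] {M : POVM Ω H} {J : Ξ →L[ℝ] Ξ}
    (hJ : S.IsMeasFisher θ M J) (φ χ : Ξ) : ⟪φ, J χ⟫_ℝ = ⟪χ, J φ⟫_ℝ := by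
  obtain ⟨P, -, -, l, -, -, h⟩ := hJ
  rw [h, h]
  simp only [mul_comm]

/-- On the diagonal the claim is that the second moment of `l φ` is at most the squared
Hilbert–Schmidt norm of `A φ`, which is the Riesz bound. -/
theorem IsMeasFisher.le_of_isSLDFisher (hθ : θ ∈ S.Θ) {Ω : Type*} [MeasurableSpace Ω]
    {M : POVM Ω H} {J JS : Ξ →L[ℝ] Ξ} (hJ : S.IsMeasFisher θ M J) (hJS : S.IsSLDFisher θ JS) :
    J ≤ JS := by
  have hsymm := hJ.symm
  obtain ⟨P, hP, -, l, hl, -, h⟩ := hJ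
  obtain ⟨A, hA, h'⟩ := hJS
  refine le_of_inner_le (fun φ χ => ?_) (fun φ χ => ?_) fun φ => ?_
  · rw [conj_trivial, hsymm]
  · rw [conj_trivial, h', h', ← (hA φ).isHilbertSchmidt.inner_vec (hA χ).isHilbertSchmidt,
      ← (hA χ).isHilbertSchmidt.inner_vec (hA φ).isHilbertSchmidt]
    exact inner_re_symm (𝕜 := ℂ) _ _
  · have := (hP θ hθ).1
    rw [h, h', hsInner_self (hA φ).isHilbertSchmidt, Complex.ofReal_re]
    simp only [← sq]
    exact hP.integral_sq_le hθ (hsNorm_nonneg _)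
      ((hA φ).boundedBy (S.isDensity θ hθ) (hP θ hθ).2) (hl φ)

end Model

/-! ### Complex linear extensions and the right information operator. -/

instance [CompleteSpace Ξ] : CompleteSpace (Cx Ξ) :=
  inferInstanceAs (CompleteSpace (WithLp 2 (Ξ × Ξ)))

theorem Cx.norm_re_le (φ : Cx Ξ) : ‖φ.re‖ ≤ ‖φ‖ :=
  le_of_sq_le_sq (by rw [Cx.norm_sq φ]; linarith [sq_nonneg ‖φ.im‖]) (norm_nonneg _)

theorem Cx.norm_im_le (φ : Cx Ξ) : ‖φ.im‖ ≤ ‖φ‖ :=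
  le_of_sq_le_sq (by rw [Cx.norm_sq φ]; linarith [sq_nonneg ‖φ.re‖]) (norm_nonneg _)

/-- The complex linear extension of a bounded real linear map into a complex Hilbert space. -/
def Cx.lift {E : Type*} [NormedAddCommGroup E] [InnerProductSpace ℂ E] (T : Ξ →L[ℝ] E) :
    Cx Ξ →L[ℂ] E :=
  LinearMap.mkContinuous
    { toFun := fun φ => T φ.re + Complex.I • T φ.im
      map_add' := fun φ χ => by
        simp only [Cx.re_add, Cx.im_add, map_add, smul_add]; abel
      map_smul' := fun z φ => by
        have hz : ∀ x : E, z • x = z.re • x + Complex.I • (z.im • x) := fun x => by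
          conv_lhs => rw [← Complex.re_add_im z]
          rw [add_smul, mul_comm, mul_smul]; rfl
        have hI : ∀ x : E, Complex.I • Complex.I • x = -x := fun x => by
          rw [smul_smul, Complex.I_mul_I, neg_one_smul]
        simp only [Cx.re_smul, Cx.im_smul, map_add, map_sub, map_smul, smul_add, RingHom.id_apply,
          hz (T φ.re), hz (Complex.I • T φ.im)]
        rw [smul_comm z.im Complex.I, hI, smul_comm z.re Complex.I]
        abel }
    (2 * ‖T‖) (fun φ => by
      have h1 := (T.le_opNorm φ.re).trans
        (mul_le_mul_of_nonneg_left (Cx.norm_re_le φ) (norm_nonneg T))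
      have h2 := (T.le_opNorm φ.im).trans
        (mul_le_mul_of_nonneg_left (Cx.norm_im_le φ) (norm_nonneg T))
      have h3 := norm_add_le (T φ.re) (Complex.I • T φ.im)
      rw [norm_smul, Complex.norm_I, one_mul] at h3
      exact h3.trans (by linarith))

theorem Cx.lift_apply {E : Type*} [NormedAddCommGroup E] [InnerProductSpace ℂ E] (T : Ξ →L[ℝ] E)
    (φ : Cx Ξ) : Cx.lift T φ = T φ.re + Complex.I • T φ.im := rfl

theorem inner_add_I_smul {E : Type*} [NormedAddCommGroup E] [InnerProductSpace ℂ E]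
    (a b c d : E) : ⟪a + Complex.I • b, c + Complex.I • d⟫_ℂ =
      ⟪a, c⟫_ℂ + Complex.I * ⟪a, d⟫_ℂ - Complex.I * ⟪b, c⟫_ℂ + ⟪b, d⟫_ℂ := by
  simp only [inner_add_left, inner_add_right, inner_smul_left, inner_smul_right, Complex.conj_I]
  linear_combination (-⟪b, d⟫_ℂ) * Complex.I_mul_I

namespace Model

variable {S : Model H Ξ} {θ : Ξ}

theorem HasRLD.existsUnique_isRLDFisher [CompleteSpace Ξ] (hθ : θ ∈ S.Θ) (h : S.HasRLD θ) :
    ∃! J, S.IsRLDFisher θ J := by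
  obtain ⟨Y, hY, T, hT⟩ := h.exists_clm hθ
  obtain ⟨J, hJ⟩ := exists_gram (Cx.lift T)
  have hJ' : ∀ φ χ : Cx Ξ, ⟪φ, J χ⟫_ℂ =
      hsInner (Y φ.re) (Y χ.re) + Complex.I * hsInner (Y φ.re) (Y χ.im)
        - Complex.I * hsInner (Y φ.im) (Y χ.re) + hsInner (Y φ.im) (Y χ.im) := fun φ χ => by
    rw [hJ, Cx.lift_apply, Cx.lift_apply, inner_add_I_smul, hT, hT, hT, hT]
    rfl
  refine ⟨J, ⟨Y, hY, hJ'⟩, ?_⟩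
  rintro J' ⟨Y', hY', h'⟩
  refine ContinuousLinearMap.ext fun χ => ?_
  refine ext_inner_left ℂ fun φ => ?_
  have e : ∀ φ, Y' φ = Y φ := fun φ =>
    (hY' φ).unique (S.isDensity θ hθ) (S.isStrictlyPos θ hθ) (hY φ)
  rw [h', hJ']
  simp only [e]

/-- For `φ₁ + i φ₂` the operator `Y(φ₁) + i Y(φ₂)` solves the right equation for `D[φ₁] + i D[φ₂]`,
since that equation asks for no self-adjointness. The density of the latter is `l(φ₁) + i l(φ₂)`,
and its squared modulus has no cross terms because the `l` are real, so the complex Riesz bound is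
the claim. -/
theorem IsMeasFisher.map_le_of_isRLDFisher (hθ : θ ∈ S.Θ) {Ω : Type*} [MeasurableSpace Ω]
    {M : POVM Ω H} {J : Ξ →L[ℝ] Ξ} {JR : Cx Ξ →L[ℂ] Cx Ξ} (hJ : S.IsMeasFisher θ M J)
    (hJR : S.IsRLDFisher θ JR) : Cx.map J ≤ JR := by
  have hsymm := hJ.symm
  obtain ⟨P, hP, -, l, hl, hl2, h⟩ := hJ
  obtain ⟨Y, hY, h'⟩ := hJR
  have hYHS := fun φ => (hY φ).isHilbertSchmidt
  have hJR : ∀ φ χ : Cx Ξ, ⟪φ, JR χ⟫_ℂ =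
      ⟪(hYHS φ.re).vec + Complex.I • (hYHS φ.im).vec,
        (hYHS χ.re).vec + Complex.I • (hYHS χ.im).vec⟫_ℂ := fun φ χ => by
    rw [h', inner_add_I_smul]; rfl
  refine le_of_inner_le (fun φ χ => ?_) (fun φ χ => ?_) fun φ => ?_
  · rw [Cx.inner_def, Cx.inner_def]
    simp only [Cx.re_map, Cx.im_map]
    rw [hsymm χ.re φ.re, hsymm χ.im φ.im, hsymm χ.re φ.im, hsymm χ.im φ.re]
    apply Complex.ext <;> simp
  · rw [hJR, hJR, inner_conj_symm]
  · have := (hP θ hθ).1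
    have hr := S.isDensity θ hθ
    have hRLD := (hY φ.re).add ((hY φ.im).smul Complex.I)
    have hvec : (hYHS φ.re).vec + Complex.I • (hYHS φ.im).vec = hRLD.isHilbertSchmidt.vec := rfl
    rw [hJR, hvec, inner_self_eq_norm_sq, hRLD.isHilbertSchmidt.norm_vec, Cx.inner_def]
    simp only [Cx.re_map, Cx.im_map]
    have h1 := (hP.isLogDeriv_iff hθ).1 (hl φ.re)
    have h2 := (hP.isLogDeriv_iff hθ).1 (hl φ.im)
    have i1 : Integrable (fun ω => (l φ.re ω : ℂ)) (P θ) := h1.1.ofReal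
    have i2 : Integrable (fun ω => Complex.I * (l φ.im ω : ℂ)) (P θ) := h2.1.ofReal.const_mul _
    have hbound := POVM.BoundedBy.integral_norm_sq_le (d := S.D θ φ.re + Complex.I • S.D θ φ.im)
      (fun X => by
        rw [← hRLD.eqn, mul_assoc]
        exact hr.isHilbertSchmidt_sqrt.diagSummable_mul (hRLD.isHilbertSchmidt.mul_right X))
      (hsNorm_nonneg _) (hRLD.boundedBy hr (hP θ hθ).2) (i1.add i2) fun B hB => by
        have : ∫ ω in B, ((fun ω => (l φ.re ω : ℂ)) + fun ω => Complex.I * (l φ.im ω : ℂ)) ω ∂(P θ)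
            = ∫ ω in B, (l φ.re ω : ℂ) ∂(P θ) + ∫ ω in B, Complex.I * (l φ.im ω : ℂ) ∂(P θ) :=
          integral_add i1.integrableOn i2.integrableOn
        rw [this, integral_const_mul, h1.2 B hB, h2.2 B hB, add_mul,
          trace_add (S.diagSummable_D hθ _ _), smul_mul_assoc, trace_smul]
        rw [smul_mul_assoc]
        refine (Summable.mul_left Complex.I (S.diagSummable_D hθ φ.im (M.toFun B))).congr
          fun i => ?_
        rw [smul_apply, inner_smul_right]
    refine le_trans (le_of_eq ?_) hbound
    rw [h, h]
    refine (integral_add ((hl2 φ.re).integrable_mul (hl2 φ.re))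
      ((hl2 φ.im).integrable_mul (hl2 φ.im))).symm.trans (integral_congr_ae ?_)
    refine Eventually.of_forall fun ω => ?_
    simp only [Pi.add_apply, Pi.mul_apply]
    rw [Complex.sq_norm, Complex.normSq_apply]
    simp

end Model

end LogarithmicDerivative

/-! ### The spectral measure of a representation of `C(X)` -/

section Spectral

open CompactlySupported

variable {K : Type*} [NormedAddCommGroup K] [InnerProductSpace ℂ K] [CompleteSpace K]
  {X : Type*} [MetricSpace X] [CompactSpace X] [MeasurableSpace X] [BorelSpace X]

/-- A real continuous function as a complex one. -/
def toCx (f : C(X, ℝ)) : C(X, ℂ) := ⟨fun x => (f x : ℂ), by fun_prop⟩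

theorem toCx_apply (f : C(X, ℝ)) (x : X) : toCx f x = (f x : ℂ) := rfl

theorem star_toCx (f : C(X, ℝ)) : star (toCx f) = toCx f := by
  ext x; simp [toCx_apply]

variable (Φ : C(X, ℂ) →⋆ₐ[ℂ] (K →L[ℂ] K))

/-- A nonnegative function is `g* g` with `g` its square root. -/
theorem inner_toCx_nonneg {f : C(X, ℝ)} (hf : 0 ≤ f) (x : K) : 0 ≤ (⟪x, Φ (toCx f) x⟫_ℂ).re := by
  let g : C(X, ℝ) := ⟨fun z => √(f z), by fun_prop⟩
  have h : toCx f = star (toCx g) * toCx g := by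
    rw [star_toCx]
    ext z
    have hz : √(f z) * √(f z) = f z := Real.mul_self_sqrt (hf z)
    rw [ContinuousMap.mul_apply, toCx_apply, toCx_apply, ← Complex.ofReal_mul]
    exact congrArg _ hz.symm
  rw [h, map_mul, map_star, mul_apply_eq_comp, inner_apply_star]
  exact inner_self_nonneg (𝕜 := ℂ)

theorem ofReal_inner_toCx (f : C(X, ℝ)) (x : K) :
    (((⟪x, Φ (toCx f) x⟫_ℂ).re : ℝ) : ℂ) = ⟪x, Φ (toCx f) x⟫_ℂ := by
  refine Complex.conj_eq_iff_re.1 ?_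
  rw [inner_conj_symm, ← inner_apply_star, ← map_star, star_toCx]

/-- The positive functional `f ↦ ⟪x, Φ(f) x⟫`. -/
def spectralFunctional (x : K) : C_c(X, ℝ) →ₚ[ℝ] ℝ :=
  PositiveLinearMap.mk₀
    { toFun := fun f => (⟪x, Φ (toCx f.toContinuousMap) x⟫_ℂ).re
      map_add' := fun f g => by
        have : toCx (f + g).toContinuousMap = toCx f.toContinuousMap + toCx g.toContinuousMap := by
          ext z; simp [toCx_apply]
        rw [this, map_add, add_apply, inner_add_right, Complex.add_re]
      map_smul' := fun c f => by
        have : toCx (c • f).toContinuousMap = (c : ℂ) • toCx f.toContinuousMap := by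
          ext z; simp [toCx_apply]
        rw [this, map_smul, smul_apply, inner_smul_right, Complex.re_ofReal_mul]
        rfl }
    fun f hf => inner_toCx_nonneg Φ (f := f.toContinuousMap) hf x

/-- The measure `μ` with `∫ f dμ = ⟪x, Φ(f) x⟫`. -/
def spectralMeasure (x : K) : Measure X := RealRMK.rieszMeasure (spectralFunctional Φ x)

instance (x : K) : IsFiniteMeasure (spectralMeasure Φ x) :=
  inferInstanceAs (IsFiniteMeasure (RealRMK.rieszMeasure (spectralFunctional Φ x)))

theorem integral_spectralMeasure (x : K) (f : C(X, ℝ)) :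
    ∫ z, f z ∂(spectralMeasure Φ x) = (⟪x, Φ (toCx f) x⟫_ℂ).re :=
  RealRMK.integral_rieszMeasure (spectralFunctional Φ x)
    (CompactlySupportedContinuousMap.continuousMapEquiv f)

theorem eq_spectralMeasure {μ : Measure X} [IsFiniteMeasure μ] {x : K}
    (h : ∀ f : C(X, ℝ), ∫ z, f z ∂μ = (⟪x, Φ (toCx f) x⟫_ℂ).re) : μ = spectralMeasure Φ x :=
  Measure.ext_of_integral_eq_on_compactlySupported fun f =>
    (h f.toContinuousMap).trans (integral_spectralMeasure Φ x f.toContinuousMap).symm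

theorem spectralMeasure_real_univ (x : K) : (spectralMeasure Φ x).real Set.univ = ‖x‖ ^ 2 := by
  have h := integral_spectralMeasure Φ x 1
  have h1 : toCx (1 : C(X, ℝ)) = 1 := by ext z; simp [toCx_apply]
  rw [h1, map_one] at h
  simp only [ContinuousMap.one_apply, integral_const, smul_eq_mul, mul_one] at h
  rw [h]
  exact inner_self_eq_norm_sq (𝕜 := ℂ) x

/-- `⟪Φ(g) x, Φ(f) Φ(g) x⟫ = ⟪x, Φ(|g|² f) x⟫`, and a finite measure is determined by its integrals
of continuous functions. -/
theorem spectralMeasure_apply_eq_withDensity (g : C(X, ℂ)) (x : K) :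
    spectralMeasure Φ (Φ g x) =
      (spectralMeasure Φ x).withDensity fun z => ((‖g z‖₊ ^ 2 : NNReal) : ℝ≥0∞) := by
  have hg : Measurable fun z => ‖g z‖₊ ^ 2 := by fun_prop
  have hfin : IsFiniteMeasure
      ((spectralMeasure Φ x).withDensity fun z => ((‖g z‖₊ ^ 2 : NNReal) : ℝ≥0∞)) := by
    have h := isFiniteMeasure_withDensity_ofReal (μ := spectralMeasure Φ x)
      (f := fun z => ‖g z‖ ^ 2) ((BoundedContinuousFunction.mkOfCompact
        (⟨fun z => ‖g z‖ ^ 2, by fun_prop⟩ : C(X, ℝ))).integrable _).2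
    convert h using 3 with z
    rw [ENNReal.ofReal_pow (norm_nonneg _), ofReal_norm, ENNReal.coe_pow]
    rfl
  refine (eq_spectralMeasure Φ fun f => ?_).symm
  rw [integral_withDensity_eq_integral_smul hg]
  let F : C(X, ℝ) := ⟨fun z => ‖g z‖ ^ 2 * f z, by fun_prop⟩
  have h := integral_spectralMeasure Φ x F
  have h1 : toCx F = star g * (toCx f * g) := by
    ext z
    have : ((‖g z‖ ^ 2 : ℝ) : ℂ) = star (g z) * g z := by
      rw [Complex.star_def, mul_comm, Complex.mul_conj, Complex.normSq_eq_norm_sq]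
    rw [toCx_apply]
    change ((‖g z‖ ^ 2 * f z : ℝ) : ℂ) = star (g z) * ((f z : ℂ) * g z)
    rw [Complex.ofReal_mul, this]
    ring
  rw [h1, map_mul, map_mul, map_star, mul_apply_eq_comp, mul_apply_eq_comp, inner_apply_star] at h
  exact h

/-- Simultaneous approximation of the measures of a set by operators in the range of `Φ`. -/
theorem exists_tendsto_spectralMeasure {B : Set X} (hB : MeasurableSet B) {ι : Type*} [Fintype ι]
    (v : ι → K) : ∃ T : ℕ → K →L[ℂ] K, (∀ n, ‖T n‖ ≤ 1) ∧ ∀ i,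
      Tendsto (fun n => ⟪v i, T n (v i)⟫_ℂ) atTop (𝓝 ((spectralMeasure Φ (v i)).real B : ℂ)) := by
  -- The sum dominates every measure involved, so one sequence approximating the indicator of `B` in
  -- `L¹(μ)` serves all vectors at once.
  let μ : Measure X := ∑ i, spectralMeasure Φ (v i)
  have hle : ∀ i, spectralMeasure Φ (v i) ≤ μ := fun i =>
    Finset.single_le_sum (f := fun i => spectralMeasure Φ (v i)) (fun _ _ => bot_le)
      (Finset.mem_univ i)
  have hind : Integrable (B.indicator fun _ => (1 : ℝ)) μ := (integrable_const 1).indicator hB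
  choose g hg hgi using fun n : ℕ => hind.exists_boundedContinuous_integral_sub_le
    (ε := 1 / ((n : ℝ) + 1)) (by positivity)
  -- Truncation to `[0, 1]` makes the operators contractions and does not increase the distance to
  -- an indicator.
  let f : ℕ → C(X, ℝ) := fun n => ⟨fun z => max 0 (min (g n z) 1), by fun_prop⟩
  have hf : ∀ n z, f n z = max 0 (min (g n z) 1) := fun _ _ => rfl
  have hfi : ∀ n (ν : Measure X) [IsFiniteMeasure ν], Integrable (f n) ν := fun n ν _ =>
    (BoundedContinuousFunction.mkOfCompact (f n)).integrable ν
  refine ⟨fun n => Φ (toCx (f n)), fun n => ?_, fun i => ?_⟩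
  · refine (NonUnitalStarAlgHom.norm_apply_le Φ _).trans ((ContinuousMap.norm_le _ zero_le_one).2 fun z => ?_)
    rw [toCx_apply, Complex.norm_real, hf, Real.norm_eq_abs, abs_of_nonneg (le_max_left _ _)]
    exact max_le zero_le_one (min_le_right _ _)
  · refine Tendsto.congr (fun n => ofReal_inner_toCx Φ (f n) (v i))
      ((Complex.continuous_ofReal.tendsto _).comp ?_)
    refine Tendsto.congr (fun n => integral_spectralMeasure Φ (v i) (f n)) ?_
    rw [tendsto_iff_norm_sub_tendsto_zero]
    refine squeeze_zero (fun _ => norm_nonneg _) (fun n => ?_)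
      (tendsto_one_div_add_atTop_nhds_zero_nat (𝕜 := ℝ))
    have hi1 : Integrable (B.indicator fun _ => (1 : ℝ)) (spectralMeasure Φ (v i)) :=
      (integrable_const 1).indicator hB
    have h1 : (spectralMeasure Φ (v i)).real B
        = ∫ z, B.indicator (fun _ => (1 : ℝ)) z ∂(spectralMeasure Φ (v i)) := by
      rw [integral_indicator hB]; simp
    rw [h1, norm_sub_rev, ← integral_sub hi1 (hfi n _)]
    refine (norm_integral_le_integral_norm _).trans (le_trans ?_ (hg n))
    refine le_trans (integral_mono_measure (hle i) (Eventually.of_forall fun _ => norm_nonneg _)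
      (hind.sub (hfi n _)).norm) ?_
    refine integral_mono (hind.sub (hfi n _)).norm (hind.sub (hgi n)).norm fun z => ?_
    simp only [Real.norm_eq_abs, hf]
    by_cases hz : z ∈ B
    · simp only [Set.indicator_of_mem hz]
      rcases le_total (g n z) 1 with h | h
      · rw [min_eq_left h]
        rcases le_total 0 (g n z) with h' | h'
        · rw [max_eq_right h']
        · rw [max_eq_left h', abs_of_nonneg (by norm_num), abs_of_nonneg (by linarith)]
          linarith
      · rw [min_eq_right h]; simp
    · simp only [Set.indicator_of_notMem hz, zero_sub, abs_neg]
      rw [abs_of_nonneg (le_max_left _ _)]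
      exact max_le (abs_nonneg _) ((min_le_left _ _).trans (le_abs_self _))

/-- Polarization of a quadratic form. -/
def polar (q : K → ℂ) (x y : K) : ℂ :=
  (q (x + y) - q (x - y) - Complex.I * q (x + Complex.I • y) + Complex.I * q (x - Complex.I • y)) / 4

theorem polar_inner (T : K →L[ℂ] K) (x y : K) : polar (fun z => ⟪z, T z⟫_ℂ) x y = ⟪x, T y⟫_ℂ := by
  simp only [polar, map_add, map_sub, map_smul, inner_add_left, inner_add_right, inner_sub_left,
    inner_sub_right, inner_smul_left, inner_smul_right, Complex.conj_I]
  linear_combination (-(1 / 2 : ℂ) * ⟪x, T y⟫_ℂ + (1 / 2 : ℂ) * ⟪y, T x⟫_ℂ) * Complex.I_mul_I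

/-- Approximate simultaneously at the four polarization vectors of every pair. Identities of
sesquilinear forms then pass to the limit. -/
theorem exists_tendsto_polar {B : Set X} (hB : MeasurableSet B) {ι : Type*} [Fintype ι]
    (v : ι → K) : ∃ T : ℕ → K →L[ℂ] K, (∀ n, ‖T n‖ ≤ 1) ∧ ∀ i j,
      Tendsto (fun n => ⟪v i, T n (v j)⟫_ℂ) atTop
        (𝓝 (polar (fun z => ((spectralMeasure Φ z).real B : ℂ)) (v i) (v j))) := by
  obtain ⟨T, hT1, hT⟩ := exists_tendsto_spectralMeasure Φ hB (ι := ι × ι × Fin 4) fun p =>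
    ![v p.1 + v p.2.1, v p.1 - v p.2.1, v p.1 + Complex.I • v p.2.1,
      v p.1 - Complex.I • v p.2.1] p.2.2
  refine ⟨T, hT1, fun i j => ?_⟩
  refine Tendsto.congr (fun n => polar_inner (T n) (v i) (v j)) ?_
  exact ((((hT (i, j, 0)).sub (hT (i, j, 1))).sub ((hT (i, j, 2)).const_mul _)).add
    ((hT (i, j, 3)).const_mul _)).div_const 4

/-- The polarized measure of `B` is a limit of forms of contractions. The sequence depends on the
vectors, but each axiom of a bounded sesquilinear form involves finitely many, so it is inherited;
the bounded form is then represented by an operator. -/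
theorem exists_spectralOperator {B : Set X} (hB : MeasurableSet B) :
    ∃ E : K →L[ℂ] K, ∀ x, ⟪x, E x⟫_ℂ = ((spectralMeasure Φ x).real B : ℂ) := by
  set β := polar (fun z => ((spectralMeasure Φ z).real B : ℂ)) with hβ
  let b₀ : K →ₗ⋆[ℂ] K →ₗ[ℂ] ℂ := LinearMap.mk₂'ₛₗ (starRingEnd ℂ) (RingHom.id ℂ) β
    (fun x y z => by
      obtain ⟨T, -, hT⟩ := exists_tendsto_polar Φ hB ![x, y, z, x + y]
      refine tendsto_nhds_unique (hT 3 2) (((hT 0 2).add (hT 1 2)).congr fun n => ?_)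
      exact (inner_add_left x y _).symm)
    (fun c x y => by
      obtain ⟨T, -, hT⟩ := exists_tendsto_polar Φ hB ![x, y, c • x]
      refine tendsto_nhds_unique (hT 2 1) (((hT 0 1).const_mul (starRingEnd ℂ c)).congr fun n => ?_)
      exact (inner_smul_left x _ c).symm)
    (fun x y z => by
      obtain ⟨T, -, hT⟩ := exists_tendsto_polar Φ hB ![x, y, z, y + z]
      refine tendsto_nhds_unique (hT 0 3) (((hT 0 1).add (hT 0 2)).congr fun n => ?_)
      exact (inner_add_right x _ _).symm.trans (congrArg _ (map_add (T n) y z).symm))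
    (fun c x y => by
      obtain ⟨T, -, hT⟩ := exists_tendsto_polar Φ hB ![x, y, c • y]
      refine tendsto_nhds_unique (hT 0 2) (((hT 0 1).const_mul c).congr fun n => ?_)
      exact (inner_smul_right x _ c).symm.trans (congrArg _ (map_smul (T n) c y).symm))
  let b : K →L⋆[ℂ] K →L[ℂ] ℂ := b₀.mkContinuous₂ 1 fun x y => by
    obtain ⟨T, hT1, hT⟩ := exists_tendsto_polar Φ hB ![x, y]
    refine le_of_tendsto (hT 0 1).norm (Eventually.of_forall fun n => ?_)
    refine (norm_inner_le_norm _ _).trans ?_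
    rw [one_mul]
    refine mul_le_mul_of_nonneg_left ?_ (norm_nonneg _)
    exact ((T n).le_opNorm _).trans (mul_le_of_le_one_left (norm_nonneg _) (hT1 n))
  refine ⟨InnerProductSpace.continuousLinearMapOfBilin b, fun x => ?_⟩
  rw [← inner_conj_symm, InnerProductSpace.continuousLinearMapOfBilin_apply]
  have h1 : b x x = ((spectralMeasure Φ x).real B : ℂ) := by
    obtain ⟨T, -, hT⟩ := exists_tendsto_spectralMeasure Φ hB
      ![x, x + x, x - x, x + Complex.I • x, x - Complex.I • x]
    refine tendsto_nhds_unique ?_ (hT 0)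
    have h2 : Tendsto (fun n => polar (fun z => ⟪z, T n z⟫_ℂ) x x) atTop (𝓝 (β x x)) := by
      simp only [hβ, polar]
      exact ((((hT 1).sub (hT 2)).sub ((hT 3).const_mul _)).add ((hT 4).const_mul _)).div_const 4
    simp only [polar_inner] at h2
    exact h2
  rw [h1, Complex.conj_ofReal]

/-- The spectral measure of a representation of `C(X)` as a positive operator-valued measure. -/
theorem exists_spectralPOVM : ∃ E : POVM X K, ∀ x, E.measure x = spectralMeasure Φ x := by
  classical
  choose E hE using fun B : {B : Set X // MeasurableSet B} => exists_spectralOperator Φ B.2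
  let F : Set X → K →L[ℂ] K := fun B => if h : MeasurableSet B then E ⟨B, h⟩ else 0
  have hF : ∀ B, MeasurableSet B → ∀ x, ⟪x, F B x⟫_ℂ = ((spectralMeasure Φ x).real B : ℂ) :=
    fun B hB x => by simp only [F, dif_pos hB, hE]
  let M : POVM X K :=
    { toFun := F
      isPositive := fun B hB => by
        refine (ContinuousLinearMap.isPositive_iff_complex _).2 fun x => ?_
        rw [← inner_conj_symm, hF B hB, Complex.conj_ofReal]
        exact ⟨by simp, by simp [measureReal_nonneg]⟩
      map_univ := by
        refine eq_of_forall_inner_self_eq fun x => ?_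
        rw [hF _ MeasurableSet.univ, spectralMeasure_real_univ, one_apply_eq_self,
          inner_self_eq_norm_sq_to_K]
        simp
      hasSum_iUnion := fun B hB hd x y => by
        have hq : ∀ z, HasSum (fun n => ⟪z, F (B n) z⟫_ℂ) ⟪z, F (⋃ n, B n) z⟫_ℂ := fun z => by
          simp only [hF _ (hB _), hF _ (MeasurableSet.iUnion hB)]
          refine Complex.hasSum_ofReal.2 ?_
          have hne : ∑' n, spectralMeasure Φ z (B n) ≠ ∞ := by
            rw [← measure_iUnion hd hB]
            exact measure_ne_top _ _
          rw [measureReal_def, measure_iUnion hd hB,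
            ENNReal.tsum_toReal_eq fun n => measure_ne_top _ _]
          exact ENNReal.hasSum_toReal hne
        rw [← polar_inner]
        refine HasSum.congr_fun ?_ fun n => (polar_inner (F (B n)) x y).symm
        exact ((((hq _).sub (hq _)).sub ((hq _).mul_left _)).add ((hq _).mul_left _)).div_const 4 }
  refine ⟨M, fun x => Measure.ext fun B hB => ?_⟩
  refine (measureReal_eq_measureReal_iff).1 (Complex.ofReal_injective ?_)
  rw [M.ofReal_measure_real x hB]
  exact hF B hB x

end Spectral

/-! ### Unitary dilation -/

section Dilation

variable {H : Type*} [NormedAddCommGroup H] [InnerProductSpace ℂ H] [CompleteSpace H]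

/-- The operator on `H ⊕ H` given by a matrix of operators. -/
def blockOp (a b c d : H →L[ℂ] H) : WithLp 2 (H × H) →L[ℂ] WithLp 2 (H × H) :=
  (WithLp.prodContinuousLinearEquiv 2 ℂ H H).symm.toContinuousLinearMap ∘L
    ((a ∘L ContinuousLinearMap.fst ℂ H H + b ∘L ContinuousLinearMap.snd ℂ H H).prod
      (c ∘L ContinuousLinearMap.fst ℂ H H + d ∘L ContinuousLinearMap.snd ℂ H H)) ∘L
    (WithLp.prodContinuousLinearEquiv 2 ℂ H H).toContinuousLinearMap

theorem blockOp_apply (a b c d : H →L[ℂ] H) (x : WithLp 2 (H × H)) :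
    blockOp a b c d x = WithLp.toLp 2 (a x.fst + b x.snd, c x.fst + d x.snd) := rfl

theorem star_blockOp (a b c d : H →L[ℂ] H) :
    star (blockOp a b c d) = blockOp (star a) (star c) (star b) (star d) := by
  refine ContinuousLinearMap.ext fun y => ext_inner_left ℂ fun x => ?_
  rw [inner_apply_star, blockOp_apply, blockOp_apply, WithLp.prod_inner_apply,
    WithLp.prod_inner_apply]
  simp only [inner_add_left, inner_add_right, inner_apply_star, WithLp.fst, WithLp.snd]
  ring

theorem blockOp_mul (a b c d a' b' c' d' : H →L[ℂ] H) :
    blockOp a b c d * blockOp a' b' c' d' =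
      blockOp (a * a' + b * c') (a * b' + b * d') (c * a' + d * c') (c * b' + d * d') := by
  refine ContinuousLinearMap.ext fun x => ?_
  rw [mul_apply_eq_comp, blockOp_apply, blockOp_apply, blockOp_apply]
  simp only [add_apply, mul_apply_eq_comp, map_add, WithLp.fst, WithLp.snd]
  congr 2 <;> abel

theorem blockOp_one : blockOp (1 : H →L[ℂ] H) 0 0 1 = 1 := by
  refine ContinuousLinearMap.ext fun x => ?_
  rw [blockOp_apply]
  simp
  rfl

/-- The embedding of `H` in `H ⊕ H`. -/
def inlIsometry (H : Type*) [NormedAddCommGroup H] [InnerProductSpace ℂ H] :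
    H →ₗᵢ[ℂ] WithLp 2 (H × H) where
  toFun x := WithLp.toLp 2 (x, 0)
  map_add' x y := by
    rw [← WithLp.toLp_add]; simp
  map_smul' c x := by
    rw [RingHom.id_apply, ← WithLp.toLp_smul]; simp
  norm_map' x := by
    refine (sq_eq_sq₀ (norm_nonneg _) (norm_nonneg _)).1 ?_
    rw [WithLp.prod_norm_sq_eq_of_L2]
    simp

/-- If `‖F x‖ = ‖G x‖` for all `x`, then `G x ↦ F x` extends to a unitary operator on `H ⊕ H`. -/
theorem exists_unitaryDilation {F G : H →L[ℂ] H} (h : ∀ x, ‖F x‖ = ‖G x‖) :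
    ∃ U ∈ unitary (WithLp 2 (H × H) →L[ℂ] WithLp 2 (H × H)),
      ∀ x, U (inlIsometry H (G x)) = inlIsometry H (F x) := by
  obtain ⟨C, hCG, hC, hG, -⟩ := exists_partialIsometry h
  have hC' : star C * C * star C = star C := by
    have := congrArg star hC
    rwa [star_mul, star_mul, star_star] at this
  have hC2 : C * star C * C = C := by rw [mul_assoc, hC]
  have hC2' : star C * (C * star C) = star C := by rw [← mul_assoc, hC']
  have hp : star C * C * (star C * C) = star C * C := by rw [← mul_assoc, hC']
  have hq : C * star C * (C * star C) = C * star C := by rw [← mul_assoc, hC2]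
  have e1 : star C * C + (1 - star C * C) * (1 - star C * C) = 1 := by
    rw [sub_mul, one_mul, mul_sub, mul_one, hp]; abel
  have e2 : C * star C + (1 - C * star C) * (1 - C * star C) = 1 := by
    rw [sub_mul, one_mul, mul_sub, mul_one, hq]; abel
  have e3 : star C * (1 - C * star C) = 0 := by rw [mul_sub, mul_one, hC2', sub_self]
  have e4 : (1 - star C * C) * star C = 0 := by rw [sub_mul, one_mul, hC', sub_self]
  have e5 : (1 - C * star C) * C = 0 := by rw [sub_mul, one_mul, hC2, sub_self]
  have e6 : C * (1 - star C * C) = 0 := by rw [mul_sub, mul_one, hC, sub_self]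
  -- The Halmos dilation. For a partial isometry the defect operators are projections, so no square
  -- roots are needed, and `1 - C* C` kills the range of `G`.
  refine ⟨blockOp C (1 - C * star C) (1 - star C * C) (-star C), ?_, fun x => ?_⟩
  · rw [Unitary.mem_iff, star_blockOp]
    simp only [star_sub, star_one, star_mul, star_star, star_neg]
    constructor
    · rw [blockOp_mul]
      simp only [mul_neg, neg_mul, neg_neg, e1, e3, e4, e5, e6]
      rw [add_comm _ (C * star C), e2]
      simp only [neg_zero, add_zero]
      exact blockOp_one
    · rw [blockOp_mul]
      simp only [mul_neg, neg_mul, neg_neg, e2, e3, e4, e5, e6]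
      rw [add_comm _ (star C * C), e1]
      simp only [neg_zero, add_zero]
      exact blockOp_one
  · have h1 : C (G x) = F x := congrArg (fun T : H →L[ℂ] H => T x) hCG
    have h2 : star C (C (G x)) = G x := congrArg (fun T : H →L[ℂ] H => T x) hG
    rw [blockOp_apply]
    change WithLp.toLp 2 (C (G x) + (1 - C * star C) 0, (1 - star C * C) (G x) + (-star C) 0) =
      WithLp.toLp 2 (F x, (0 : H))
    rw [map_zero, map_zero, add_zero, add_zero, h1, sub_apply, mul_apply_eq_comp, h2]
    simp

/-- The continuous functional calculus of a unitary operator, on a space in an arbitrary universe. -/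
theorem exists_representation {K : Type*} [NormedAddCommGroup K] [InnerProductSpace ℂ K]
    [CompleteSpace K] {U : K →L[ℂ] K} (hU : U ∈ unitary (K →L[ℂ] K)) :
    ∃ (X : Type w) (_ : MetricSpace X) (_ : CompactSpace X) (_ : MeasurableSpace X)
      (_ : BorelSpace X) (Φ : C(X, ℂ) →⋆ₐ[ℂ] (K →L[ℂ] K)) (ζ : C(X, ℂ)),
      Φ ζ = U ∧ ∀ z, ‖ζ z‖ = 1 := by
  have hn : IsStarNormal U := ⟨by
    rw [Commute, SemiconjBy, (Unitary.mem_iff.1 hU).1, (Unitary.mem_iff.1 hU).2]⟩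
  have : CompactSpace (spectrum ℂ U) := isCompact_iff_compactSpace.1 (spectrum.isCompact U)
  let _ : MeasurableSpace (ULift.{w} (spectrum ℂ U)) := borel _
  -- Lifting the spectrum puts the outcome space in the prescribed universe.
  refine ⟨ULift.{w} (spectrum ℂ U), inferInstance, inferInstance, borel _, ⟨rfl⟩,
    (cfcHom hn).comp (ContinuousMap.compStarAlgHom' ℂ ℂ ⟨ULift.up, continuous_uliftUp⟩),
    ⟨fun z => (z.down : ℂ), continuous_subtype_val.comp continuous_uliftDown⟩, ?_, fun z => ?_⟩
  · exact cfcHom_id hn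
  · have := Unitary.spectrum_subset_circle (⟨U, hU⟩ : unitary (K →L[ℂ] K)) z.down.2
    simpa using this

variable {Ω : Type*} [MeasurableSpace Ω] {K : Type*} [NormedAddCommGroup K]
  [InnerProductSpace ℂ K] [CompleteSpace K]

/-- The compression of a positive operator-valued measure to a subspace. -/
def POVM.compress (E : POVM Ω K) (ι : H →ₗᵢ[ℂ] K) : POVM Ω H where
  toFun B := ContinuousLinearMap.adjoint ι.toContinuousLinearMap ∘L E.toFun B ∘L
    ι.toContinuousLinearMap
  isPositive B hB := (E.isPositive B hB).adjoint_conj _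
  map_univ := by
    refine ContinuousLinearMap.ext fun x => ext_inner_left ℂ fun y => ?_
    rw [E.map_univ, ContinuousLinearMap.comp_apply, ContinuousLinearMap.adjoint_inner_right]
    exact ι.inner_map_map y x
  hasSum_iUnion B hB hd x y := by
    simp only [ContinuousLinearMap.comp_apply, ContinuousLinearMap.adjoint_inner_right]
    exact E.hasSum_iUnion B hB hd _ _

theorem POVM.measure_compress (E : POVM Ω K) (ι : H →ₗᵢ[ℂ] K) (x : H) :
    (E.compress ι).measure x = E.measure (ι x) := by
  refine Measure.ext fun B hB => ?_
  rw [POVM.measure_apply _ _ hB, POVM.measure_apply _ _ hB]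
  change ENNReal.ofReal (⟪x, ContinuousLinearMap.adjoint ι.toContinuousLinearMap
    (E.toFun B (ι x))⟫_ℂ).re = _
  rw [ContinuousLinearMap.adjoint_inner_right]
  rfl

/-- A measurement which diagonalizes the symmetric operator `s x ↦ A x`. -/
theorem exists_diagonalizing_POVM {A s : H →L[ℂ] H} (hs : IsSelfAdjoint s)
    (hsA : IsSelfAdjoint (s * A)) :
    ∃ (X : Type w) (_ : MeasurableSpace X) (M : POVM X H) (g₀ g₁ : X → ℂ),
      Measurable g₀ ∧ Measurable g₁ ∧ (∀ z, ‖g₀ z‖ ≤ 1) ∧ (∀ z, ‖g₁ z‖ ≤ 1) ∧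
      (∀ z, (star (g₀ z) * g₁ z).im = 0) ∧
      ∀ (α β : ℂ) (x : H), M.measure (α • s x + β • A x) =
        (M.measure ((A + Complex.I • s) x)).withDensity
          fun z => ((‖α * g₀ z + β * g₁ z‖₊ ^ 2 : NNReal) : ℝ≥0∞) := by
  -- The Cayley transform. Self-adjointness of `s A` makes `⟪A x, s x⟫` real, so `A x ± i s x` have
  -- equal norms.
  obtain ⟨U, hU, hUx⟩ := exists_unitaryDilation (F := A - Complex.I • s) (G := A + Complex.I • s)
    fun x => by
      have h0 : ⟪A x, s x⟫_ℂ = starRingEnd ℂ ⟪A x, s x⟫_ℂ := by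
        have e1 : ⟪A x, s x⟫_ℂ = ⟪(s * A) x, x⟫_ℂ := by
          rw [mul_apply_eq_comp, ← inner_apply_star s, hs.star_eq]
        rw [e1, inner_conj_symm, ← inner_apply_star, hsA.star_eq]
      have h1 : (⟪A x, s x⟫_ℂ).im = 0 := Complex.conj_eq_iff_im.1 h0.symm
      refine (sq_eq_sq₀ (norm_nonneg _) (norm_nonneg _)).1 ?_
      rw [sub_apply, add_apply, smul_apply, @norm_sub_sq ℂ, @norm_add_sq ℂ, inner_smul_right]
      simp [h1]
  obtain ⟨X, _, _, _, _, Φ, ζ, hζ, hζ1⟩ := exists_representation.{w} hU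
  obtain ⟨E, hE⟩ := exists_spectralPOVM Φ
  -- Solving `A ± i s` for `s` and `A` gives `s = (1 - U) G / (2i)` and `A = (1 + U) G / 2` on the
  -- embedded space, where `G = A + i s`.
  let g₀ : C(X, ℂ) := (1 / (2 * Complex.I)) • (1 - ζ)
  let g₁ : C(X, ℂ) := (1 / 2 : ℂ) • (1 + ζ)
  have hg₀ : ∀ z, g₀ z = 1 / (2 * Complex.I) * (1 - ζ z) := fun _ => rfl
  have hg₁ : ∀ z, g₁ z = 1 / 2 * (1 + ζ z) := fun _ => rfl
  refine ⟨X, inferInstance, E.compress (inlIsometry H), g₀, g₁, g₀.continuous.measurable,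
    g₁.continuous.measurable, fun z => ?_, fun z => ?_, fun z => ?_, fun α β x => ?_⟩
  · have h := norm_sub_le (1 : ℂ) (ζ z)
    rw [hζ1, norm_one] at h
    rw [hg₀, norm_mul]
    simp only [one_div, norm_inv, norm_mul, Complex.norm_ofNat, Complex.norm_I]
    linarith
  · have h := norm_add_le (1 : ℂ) (ζ z)
    rw [hζ1, norm_one] at h
    rw [hg₁, norm_mul]
    simp only [one_div, norm_inv, Complex.norm_ofNat]
    linarith
  -- On the unit circle the product is `-Im ζ / 2`, hence real.
  · have h := hζ1 z
    rw [← sq_eq_sq₀ (norm_nonneg _) zero_le_one, Complex.sq_norm, Complex.normSq_apply] at h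
    rw [hg₀, hg₁]
    simp [Complex.inv_re, Complex.inv_im]
    linarith
  · rw [POVM.measure_compress, POVM.measure_compress, hE, hE]
    have h2 : inlIsometry H (α • s x + β • A x) =
        Φ (α • g₀ + β • g₁) (inlIsometry H ((A + Complex.I • s) x)) := by
      have hs' : α • s x + β • A x = (α * (1 / (2 * Complex.I)) + β * (1 / 2)) •
          ((A + Complex.I • s) x) + (β * (1 / 2) - α * (1 / (2 * Complex.I))) •
          ((A - Complex.I • s) x) := by
        rw [add_apply, sub_apply, smul_apply]
        match_scalars <;> field_simp <;> ring
      have hΦ : Φ (α • g₀ + β • g₁) = (α * (1 / (2 * Complex.I)) + β * (1 / 2)) • 1 +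
          (β * (1 / 2) - α * (1 / (2 * Complex.I))) • U := by
        simp only [g₀, g₁, map_add, map_smul, map_sub, map_one, hζ]
        module
      rw [hs', hΦ, map_add, map_smul, map_smul, ← hUx]
      rfl
    rw [h2, spectralMeasure_apply_eq_withDensity]
    rfl

end Dilation

/-! ### Attainment of the symmetric information -/

section Attainment

variable {H : Type*} [NormedAddCommGroup H] [InnerProductSpace ℂ H] [CompleteSpace H]
  {Ξ : Type*} [NormedAddCommGroup Ξ] [InnerProductSpace ℝ Ξ]
  {Ω : Type*} [MeasurableSpace Ω]

theorem measureReal_withDensity {μ : Measure Ω} [SFinite μ] {f : Ω → NNReal} (hf : Measurable f)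
    {B : Set Ω} (hB : MeasurableSet B) :
    (μ.withDensity fun z => (f z : ℝ≥0∞)).real B = ∫ z in B, (f z : ℝ) ∂μ := by
  have h := setIntegral_withDensity_eq_setIntegral_smul (μ := μ) hf (fun _ => (1 : ℝ)) hB
  simpa [NNReal.smul_def] using h

theorem POVM.apply_eq_zero (M : POVM Ω H) {B : Set Ω} (hB : MeasurableSet B) {x : H}
    (h : (M.measure x).real B = 0) : M.toFun B x = 0 := by
  have h0 : 0 ≤ M.toFun B := (ContinuousLinearMap.nonneg_iff_isPositive _).2 (M.isPositive _ hB)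
  rw [M.measure_real x hB, ← norm_sqrt_apply_sq h0, sq_eq_zero_iff, norm_eq_zero] at h
  rw [← CFC.sqrt_mul_sqrt_self _ h0, mul_apply_eq_comp, h, map_zero]

theorem eq_zero_of_forall_basis {T : H →L[ℂ] H} (h : ∀ i, T (stdBasis H i) = 0) : T = 0 := by
  ext x
  have h1 := ((stdBasis H).hasSum_repr x).mapL T
  simp only [map_smul, h, smul_zero] at h1
  simpa using h1.unique hasSum_zero

theorem re_inner_eq_measure (M : POVM Ω H) {B : Set Ω} (hB : MeasurableSet B) (a b : H) :
    (⟪a, M.toFun B b⟫_ℂ).re = ((M.measure (a + b)).real B - (M.measure (a - b)).real B) / 4 := by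
  have h : ⟪b, M.toFun B a⟫_ℂ = starRingEnd ℂ ⟪a, M.toFun B b⟫_ℂ := by
    rw [inner_conj_symm, ← inner_apply_star, (M.isPositive _ hB).isSelfAdjoint.star_eq]
  rw [M.measure_real _ hB, M.measure_real _ hB]
  simp only [map_add, map_sub, inner_add_left, inner_add_right, inner_sub_left, inner_sub_right, h,
    Complex.add_re, Complex.sub_re, Complex.conj_re]
  ring

/-- For self-adjoint `X` the two halves of the symmetric equation have conjugate traces, so only `A
√r` matters for the real part; cyclicity then moves `√r` to the left. -/
theorem IsSLD.hasSum_re_trace {r d A : H →L[ℂ] H} (hr : IsDensity r) (hA : IsSLD r d A)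
    {X : H →L[ℂ] H} (hX : IsSelfAdjoint X) :
    HasSum (fun i => (⟪CFC.sqrt r (stdBasis H i), X (A (stdBasis H i))⟫_ℂ).re)
      (trace (d * X)).re := by
  have hs := hr.isHilbertSchmidt_sqrt
  have hA' := hA.isHilbertSchmidt
  have h1 : trace (CFC.sqrt r * star A * X) = star (trace (A * CFC.sqrt r * X)) := by
    rw [← trace_star, star_mul, star_mul, star_sqrt, hX.star_eq, mul_assoc,
      trace_mul_comm hs (hA'.star.mul_right X), mul_assoc,
      trace_mul_comm hA'.star (hs.mul_left X), mul_assoc]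
  have h2 : (trace (d * X)).re = (trace (A * CFC.sqrt r * X)).re := by
    rw [← hA.eqn, smul_mul_assoc, trace_smul, add_mul, trace_add, h1]
    · simp only [Complex.star_def]
      simp
      ring
    · rw [mul_assoc]; exact hs.diagSummable_mul (hA'.star.mul_right X)
    · rw [mul_assoc]; exact hA'.diagSummable_mul (hs.mul_right X)
  have h3 := Complex.hasSum_re (hasSum_trace_mul (hs.mul_right X) hA')
  rw [← trace_mul_comm hA' (hs.mul_right X), ← mul_assoc, ← h2] at h3
  refine h3.congr_fun fun i => ?_
  rw [mul_apply_eq_comp, mul_apply_eq_comp, ← inner_star_apply (CFC.sqrt r), star_sqrt]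

namespace Model

variable {S : Model H Ξ} {θ : Ξ}

/-- The spectral measurement of the symmetric logarithmic derivative has a logarithmic derivative
whose second moment is that of the symmetric logarithmic derivative. -/
theorem exists_POVM_attaining (S : Model H Ξ) (hθ : θ ∈ S.Θ) {φ : Ξ} {A : H →L[ℂ] H}
    (hA : IsSLD (S.ρ θ) (S.D θ φ) A) :
    ∃ (X : Type w) (_ : MeasurableSpace X) (M : POVM X H) (l : X → ℝ),
      IsLogDeriv (fun ϑ => M.law (S.ρ ϑ)) S.Θ θ φ l ∧
      ∫ z, l z * l z ∂(M.law (S.ρ θ)) = hsNorm A ^ 2 := by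
  have hr := S.isDensity θ hθ
  have hr0 := S.isStrictlyPos θ hθ
  have hHS := hr.isHilbertSchmidt_sqrt
  set s := CFC.sqrt (S.ρ θ) with hsdef
  have hs : IsSelfAdjoint s := (CFC.sqrt_nonneg _).isSelfAdjoint
  obtain ⟨X, _, M, g₀, g₁, hm₀, hm₁, hb₀, hb₁, him, hM⟩ :=
    exists_diagonalizing_POVM.{w} hs hA.isSelfAdjoint
  set G := A + Complex.I • s with hG
  have hGHS : IsHilbertSchmidt G := hA.isHilbertSchmidt.add (hHS.const_smul _)
  let e := stdBasis H
  -- The law of the measurement in the unnormalized state `G G*`. Against this reference the outcome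
  -- law has density `|g₀|²`, and `|g₁|²` has integral the squared Hilbert–Schmidt norm of `A`.
  let μ : Measure X := Measure.sum fun i => M.measure (G (e i))
  have huniv : ∀ x : H, M.measure x Set.univ = ENNReal.ofReal (‖x‖ ^ 2) := fun x => by
    rw [M.measure_apply x MeasurableSet.univ, M.map_univ]
    exact congrArg _ (inner_self_eq_norm_sq (𝕜 := ℂ) x)
  have hμfin : IsFiniteMeasure μ := ⟨by
    rw [Measure.sum_apply _ MeasurableSet.univ]
    simp only [huniv]
    rw [← ENNReal.ofReal_tsum_of_nonneg (fun _ => by positivity) hGHS]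
    exact ENNReal.ofReal_lt_top⟩
  have hM₀ : ∀ x, M.measure (s x) = (M.measure (G x)).withDensity
      fun z => ((‖g₀ z‖₊ ^ 2 : NNReal) : ℝ≥0∞) := fun x => by simpa using hM 1 0 x
  have hM₁ : ∀ x, M.measure (A x) = (M.measure (G x)).withDensity
      fun z => ((‖g₁ z‖₊ ^ 2 : NNReal) : ℝ≥0∞) := fun x => by simpa using hM 0 1 x
  have hm₀' : Measurable fun z => ‖g₀ z‖₊ ^ 2 := by fun_prop
  have hm₁' : Measurable fun z => ‖g₁ z‖₊ ^ 2 := by fun_prop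
  have hP : M.law (S.ρ θ) = μ.withDensity fun z => ((‖g₀ z‖₊ ^ 2 : NNReal) : ℝ≥0∞) := by
    rw [withDensity_sum]
    exact congrArg Measure.sum (funext fun i => hM₀ (e i))
  -- the zero set of `g₀` is a null set
  let N : Set X := {z | g₀ z = 0}
  have hN : MeasurableSet N := measurableSet_eq_fun hm₀ measurable_const
  have hMN : M.toFun N = 0 := by
    -- The density `|g₀|²` vanishes on `N`, so the effect of `N` kills the range of `s`. Taking
    -- adjoints, strict positivity of the state forces that effect to be zero.
    have h1 : M.toFun N * s = 0 := eq_zero_of_forall_basis fun i => by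
      refine M.apply_eq_zero hN ?_
      change (M.measure (s (stdBasis H i))).real N = 0
      rw [hM₀, measureReal_withDensity hm₀' hN]
      refine setIntegral_eq_zero_of_forall_eq_zero fun z hz => ?_
      have hz' : g₀ z = 0 := hz
      simp [hz']
    refine eq_zero_of_sqrt_mul_eq_zero hr hr0 ?_
    have h2 := congrArg star h1
    rwa [star_mul, hs.star_eq, (M.isPositive _ hN).isSelfAdjoint.star_eq, star_zero] at h2
  have hμN : μ N = 0 := by
    rw [Measure.sum_apply _ hN]
    simp [M.measure_apply _ hN, hMN]
  have hae : ∀ᵐ z ∂μ, g₀ z ≠ 0 := by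
    rw [ae_iff]
    simpa using hμN
  let h : X → ℝ := fun z => (star (g₀ z) * g₁ z).re
  have hh : Measurable h := by fun_prop
  -- This is `g₁ / g₀`, the value of the logarithmic derivative in the spectral variable; on the
  -- null set `N` division by zero gives the harmless value `0`.
  let l : X → ℝ := fun z => h z / ‖g₀ z‖ ^ 2
  have hl : Measurable l := by fun_prop
  have hmul : ∀ z, ‖g₀ z‖ ^ 2 * l z = h z := fun z => by
    by_cases hz : g₀ z = 0
    · simp [l, h, hz]
    · exact mul_div_cancel₀ _ (by positivity)
  have hintf : ∀ f : X → ℝ, Measurable f → (∀ z, ‖f z‖ ≤ 1) → Integrable f μ := fun f hf hf1 =>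
    (integrable_const (1 : ℝ)).mono' hf.aestronglyMeasurable (Eventually.of_forall hf1)
  have hhb : ∀ z, ‖h z‖ ≤ 1 := fun z => by
    refine (Complex.abs_re_le_norm _).trans ?_
    rw [norm_mul, norm_star]
    exact mul_le_one₀ (hb₀ z) (norm_nonneg _) (hb₁ z)
  have hg₁b : ∀ z, ‖‖g₁ z‖ ^ 2‖ ≤ 1 := fun z => by
    rw [norm_pow, norm_norm]
    exact pow_le_one₀ (norm_nonneg _) (hb₁ z)
  have hli : Integrable l (M.law (S.ρ θ)) := by
    rw [hP, integrable_withDensity_iff_integrable_smul hm₀']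
    refine (hintf h hh hhb).congr (Eventually.of_forall fun z => ?_)
    simp only [NNReal.smul_def, smul_eq_mul, NNReal.coe_pow, coe_nnnorm, hmul]
  refine ⟨X, inferInstance, M, l, ⟨hli, fun B hB => ?_⟩, ?_⟩
  · have h1 := ((S.isOutcomeLaw_law M).hasFDerivWithinAt hθ hB).2 φ
    have h2 := congrArg Complex.re h1
    rw [Complex.ofReal_re] at h2
    rw [h2, hP, setIntegral_withDensity_eq_setIntegral_smul hm₀' _ hB]
    have h3 : ∀ z, (‖g₀ z‖₊ ^ 2) • l z = h z := fun z => by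
      simp only [NNReal.smul_def, smul_eq_mul, NNReal.coe_pow, coe_nnnorm, hmul]
    simp only [h3]
    rw [← integral_indicator hB]
    have h4 := hA.hasSum_re_trace hr (M.isPositive B hB).isSelfAdjoint
    have h5 := hasSum_integral_measure (μ := fun i => M.measure (G (e i)))
      ((hintf h hh hhb).indicator hB)
    refine h4.unique (h5.congr_fun fun i => ?_)
    -- Polarization: the measures of `s eᵢ ± A eᵢ` have densities `|g₀ ± g₁|²`, whose difference is
    -- `4 h`.
    have hd1 := hM 1 1 (e i)
    have hd2 := hM 1 (-1) (e i)
    simp only [one_smul, one_mul, neg_smul, neg_mul, ← sub_eq_add_neg] at hd1 hd2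
    rw [re_inner_eq_measure M hB, ← hsdef, hd1, hd2,
      measureReal_withDensity (by fun_prop) hB, measureReal_withDensity (by fun_prop) hB,
      integral_indicator hB]
    have hib : ∀ f : X → ℂ, Measurable f → (∀ z, ‖f z‖ ≤ 2) →
        IntegrableOn (fun z => ((‖f z‖₊ ^ 2 : NNReal) : ℝ)) B (M.measure (G (e i))) :=
      fun f hf hf1 => by
        refine Integrable.integrableOn ((integrable_const (4 : ℝ)).mono'
          (by fun_prop) (Eventually.of_forall fun z => ?_))
        simp only [NNReal.coe_pow, coe_nnnorm, norm_pow, norm_norm]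
        nlinarith [hf1 z, norm_nonneg (f z)]
    rw [← integral_sub (hib _ (by fun_prop) fun z => ?_) (hib _ (by fun_prop) fun z => ?_),
      ← integral_div]
    · refine integral_congr_ae (Eventually.of_forall fun z => ?_)
      simp only [NNReal.coe_pow, coe_nnnorm, Complex.sq_norm, Complex.normSq_apply, h]
      simp
      ring
    · exact (norm_add_le _ _).trans (by linarith [hb₀ z, hb₁ z])
    · exact (norm_sub_le _ _).trans (by linarith [hb₀ z, hb₁ z])
  · rw [hP, integral_withDensity_eq_integral_smul hm₀']
    have h1 : ∫ z, (‖g₀ z‖₊ ^ 2) • (l z * l z) ∂μ = ∫ z, ‖g₁ z‖ ^ 2 ∂μ := by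
      refine integral_congr_ae ?_
      filter_upwards [hae] with z hz
      have hz2 : ‖g₀ z‖ ^ 2 ≠ 0 := by positivity
      -- Since `star g₀ * g₁` is real, `h` is the whole product and its square is the product of the
      -- squared moduli; thus `|g₀|² l² = |g₁|²` off `N`.
      have hsq : h z ^ 2 = ‖g₀ z‖ ^ 2 * ‖g₁ z‖ ^ 2 := by
        have hn : ‖star (g₀ z) * g₁ z‖ ^ 2 = h z ^ 2 := by
          rw [Complex.sq_norm, Complex.normSq_apply, him z]
          simp only [h]
          ring
        rw [← hn, norm_mul, norm_star, mul_pow]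
      simp only [NNReal.smul_def, smul_eq_mul, NNReal.coe_pow, coe_nnnorm]
      rw [← mul_assoc, hmul]
      simp only [l]
      rw [mul_div_assoc', ← sq, hsq, mul_div_cancel_left₀ _ hz2]
    rw [h1]
    have h2 := hasSum_integral_measure (μ := fun i => M.measure (G (e i)))
      (hintf (fun z => ‖g₁ z‖ ^ 2) (by fun_prop) hg₁b)
    rw [hsNorm_sq, ← h2.tsum_eq]
    refine tsum_congr fun i => ?_
    have h3 := measureReal_withDensity (μ := M.measure (G (e i))) hm₁' MeasurableSet.univ
    rw [← hM₁, setIntegral_univ, measureReal_def, huniv, ENNReal.toReal_ofReal (by positivity)] at h3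
    rw [h3]
    simp

/-- The maximum of the Fisher information over all measurements is attained. -/
theorem exists_isMeasFisher_attaining [CompleteSpace Ξ] (hθ : θ ∈ S.Θ) (h : S.HasSLD θ)
    {JS : Ξ →L[ℝ] Ξ} (hJS : S.IsSLDFisher θ JS) (φ : Ξ) :
    ∃ (X : Type w) (_ : MeasurableSpace X) (M : POVM X H) (J : Ξ →L[ℝ] Ξ),
      S.IsMeasFisher θ M J ∧ ⟪φ, JS φ⟫_ℝ = ⟪φ, J φ⟫_ℝ := by
  obtain ⟨A, hA, hJ⟩ := hJS
  obtain ⟨X, _, M, l, hl, hl2⟩ := S.exists_POVM_attaining.{w} hθ (hA φ)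
  obtain ⟨J, hJM, -⟩ := h.existsUnique_isMeasFisher hθ M
  refine ⟨X, inferInstance, M, J, hJM, ?_⟩
  obtain ⟨P, hP, -, l', hl', -, hJl⟩ := hJM
  have hP' := S.isOutcomeLaw_law M
  have hae : l =ᵐ[P θ] l' φ := by
    refine IsLogDeriv.ae_eq ((hP.isLogDeriv_iff hθ).2 ?_) (hl' φ)
    have := (hP'.isLogDeriv_iff hθ).1 hl
    rwa [hP.eq hP' hθ]
  rw [hJ, hsInner_self (hA φ).isHilbertSchmidt, Complex.ofReal_re, ← hl2, hJl]
  rw [hP.eq hP' hθ] at hae ⊢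
  refine integral_congr_ae ?_
  filter_upwards [hae] with z hz
  rw [hz]

end Model

end Attainment

end QEst

end

/-- Quantum Cramér–Rao inequalities. -/
theorem mainTheorem6
    {H : Type*} [NormedAddCommGroup H] [InnerProductSpace ℂ H] [CompleteSpace H]
    [TopologicalSpace.SeparableSpace H]
    {Ξ : Type*} [NormedAddCommGroup Ξ] [InnerProductSpace ℝ Ξ] [CompleteSpace Ξ]
    [TopologicalSpace.SeparableSpace Ξ]
    (S : QEst.Model H Ξ) (θ : Ξ) (hθ : θ ∈ S.Θ) :
    (S.HasSLD θ →
      (∃! JS, S.IsSLDFisher θ JS) ∧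
      ∀ JS, S.IsSLDFisher θ JS →
        (∀ (Ω : Type w) [MeasurableSpace Ω] (M : QEst.POVM Ω H),
          (∃! JM, S.IsMeasFisher θ M JM) ∧ ∀ JM, S.IsMeasFisher θ M JM → JM ≤ JS) ∧
        ∀ φ : Ξ, IsGreatest
          {r : ℝ | ∃ (Ω : Type w) (_ : MeasurableSpace Ω) (M : QEst.POVM Ω H) (JM : Ξ →L[ℝ] Ξ),
            S.IsMeasFisher θ M JM ∧ r = ⟪φ, JM φ⟫_ℝ}
          ⟪φ, JS φ⟫_ℝ) ∧
    (S.HasRLD θ →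
      (∃! JR, S.IsRLDFisher θ JR) ∧
      ∀ JR, S.IsRLDFisher θ JR →
        ∀ (Ω : Type w) [MeasurableSpace Ω] (M : QEst.POVM Ω H),
          (∃! JM, S.IsMeasFisher θ M JM) ∧
          ∀ JM, S.IsMeasFisher θ M JM → QEst.Cx.map JM ≤ JR) := by
  refine ⟨fun h => ⟨h.existsUnique_isSLDFisher hθ, fun JS hJS =>
      ⟨fun Ω _ M => ⟨h.existsUnique_isMeasFisher hθ M, fun JM hJM =>
        hJM.le_of_isSLDFisher hθ hJS⟩, fun φ =>
      ⟨QEst.Model.exists_isMeasFisher_attaining hθ h hJS φ, ?_⟩⟩⟩,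
    fun h => ⟨h.existsUnique_isRLDFisher hθ, fun JR hJR Ω _ M =>
      ⟨h.existsUnique_isMeasFisher hθ M, fun JM hJM => hJM.map_le_of_isRLDFisher hθ hJR⟩⟩⟩
  rintro r ⟨Ω, _, M, JM, hJM, rfl⟩
  have hle := (ContinuousLinearMap.le_def _ _).1 (hJM.le_of_isSLDFisher hθ hJS)
  have hnn := hle.inner_nonneg_right φ
  rwa [sub_apply, inner_sub_right, sub_nonneg] at hnn
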